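/- Let $G$ be a finite, compact metric graph, that is, a finite collection of edges $I_j=[0,L_j]$ with $L_j>0$ ($j=1,\dots,r$), together with an equivalence relation on the set of their endpoints whose equivalence classes $v_1,\dots,v_s$ are the vertices (loops, parallel edges and several connected components are allowed). The degree of a vertex is the cardinality of its class, so that a loop counts twice; the boundary vertices are those of degree one. The core of $G$ is the largest subgraph (a set of edges with their endpoints) without vertices of degree one, and a proper core vertex is a vertex such that all edges attached to it belong to the core. Write $o(I_j)$ and $t(I_j)$ for the vertices containing the endpoints $0$ and $L_j$ of $I_j$. A function $f$ on $G$ is a family $f_j:I_j\to\mathbb C$; it is continuous on $G$ if all $f_j$ are continuous and their values at endpoints belonging to the same vertex coincide. Set $$\partial_\nu f(v_i)=\sum_{t(I_j)=v_i}f_j'(L_j)-\sum_{o(I_j)=v_i}f_j'(0).$$ Let $\alpha\in\mathbb R^s$ and let $A_\alpha$ be the operator in $L^2(G)=\bigoplus_j L^2(I_j)$ acting as $(A_\alpha f)_j=-f_j''$, whose domain consists of all $f\in L^2(G)$ such that all $f_j,f_j'$ are absolutely continuous, $(f_j'')_j\in L^2(G)$, $f$ is continuous on $G$, and $\partial_\nu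 f(v_i)-\alpha_i f(v_i)=0$ for $i=1,\dots,s$. Let $B=\{v_{i_1},\dots,v_{i_m}\}$ be a set of vertices which contains all boundary vertices and all proper core vertices of $G$. For $\mu\in\mathbb C\setminus\sigma(A_\alpha)$ let $M_{B,\alpha}(\mu)\in\mathbb C^{m\times m}$ be the matrix whose $(k,l)$ entry is $f^{(l)}(v_{i_k})$, where $f^{(l)}\in L^2(G)$, with absolutely continuous $f^{(l)}_j$ and $(f^{(l)}_j)'$, is the unique solution of $-f''=\mu f$ on all edges that is continuous on $G$ and satisfies $\partial_\nu f(v_{i_l})-\alpha_{i_l}f(v_{i_l})=1$ and $\partial_\nu f(v_i)-\alpha_i f(v_i)=0$ for all $i\neq i_l$. Assume that each cycle in $G$ (a closed path with pairwise distinct edges and pairwise distinct vertices; a loop is a cycle with one edge, and two parallel edges form a cycle) contains two edges whose lengths are linearly independent over $\mathbb Q$. Then for each $\lambda\in\mathbb R$ the following assertions hold. (i) $\lambda$ is an eigenvalue of $A_\alpha$ if and only if $\lambda$ is a pole (of positive order) of $M_{B,\alpha}$. (ii) $\dim\ker(A_\alpha-\lambda)=\operatorname{rank}\operatorname{Res}_\lambda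 M_{B,\alpha}$, where $\operatorname{Res}_\lambda M_{B,\alpha}=\frac1{2\pi i}\oint M_{B,\alpha}(\mu)\,d\mu$ over all sufficiently small circles around $\lambda$ (in particular, it is $0$ if $M_{B,\alpha}$ is analytic at $\lambda$ or has a removable singularity there). -/

import Mathlib

open MeasureTheory Filter Topology Set

/-- A finite compact metric graph with edge set `E` and vertex set `V` (both finite wherever
graphs are used): the edge `e` is the interval `[0, length e]`, with endpoints `(e, false)` (the
endpoint `0`) and `(e, true)` (the endpoint `length e`). The equivalence relation on the set of
endpoints is the kernel of the surjection `vertex`; its classes are the vertices. Loops, parallel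
edges and several connected components are allowed. -/
structure MetricGraph (V E : Type*) where
  /-- the vertex to which an endpoint of an edge belongs -/
  vertex : E × Bool → V
  vertex_surjective : Function.Surjective vertex
  /-- the length of an edge -/
  length : E → ℝ
  length_pos : ∀ e, 0 < length e

namespace MetricGraph

variable {V E : Type*} (G : MetricGraph V E)

section Combinatorics

/-- The degree of `v` in the subgraph with edge set `S`: the number of endpoints of edges of `S`
lying in the class `v` (loops count twice). -/
noncomputable def degreeIn (S : Set E) (v : V) : ℕ :=
  {p : E × Bool | p.1 ∈ S ∧ G.vertex p = v}.ncard

/-- The degree of a vertex. -/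
noncomputable def degree (v : V) : ℕ := G.degreeIn Set.univ v

/-- Boundary vertices are the vertices of degree one. -/
def IsBoundaryVertex (v : V) : Prop := G.degree v = 1

/-- The subgraph consisting of the edges in `S` and their endpoints has no vertex of degree one. -/
def HasNoLeaf (S : Set E) : Prop := ∀ v, G.degreeIn S v ≠ 1

/-- The (edge set of the) core: the largest subgraph without vertices of degree one; see
`isGreatest_core`. -/
def core : Set E := ⋃₀ {S | G.HasNoLeaf S}

/-- All edges attached to `v` belong to the core. -/
def IsProperCoreVertex (v : V) : Prop := ∀ p, G.vertex p = v → p.1 ∈ G.core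

theorem isGreatest_core [Finite E] : IsGreatest {S | G.HasNoLeaf S} G.core := by
  refine ⟨fun v hv => ?_, fun S hS => Set.subset_sUnion_of_mem hS⟩
  obtain ⟨p, hp⟩ := Set.ncard_eq_one.mp hv
  have hpm : p.1 ∈ G.core ∧ G.vertex p = v := by
    have : p ∈ ({p} : Set (E × Bool)) := rfl
    rwa [← hp] at this
  obtain ⟨⟨S, hS, hpS⟩, hpv⟩ := hpm
  refine hS v (Set.ncard_eq_one.mpr ⟨p, ?_⟩)
  ext q
  constructor
  · rintro ⟨hq, hqv⟩
    rw [← hp]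
    exact ⟨⟨S, hS, hq⟩, hqv⟩
  · rintro rfl
    exact ⟨hpS, hpv⟩

/-- A cycle of length `n + 1`: a cyclic sequence of oriented edges with pairwise distinct edges and
pairwise distinct vertices. `d i = (e, b)` is the edge `e` traversed towards its endpoint `(e, b)`,
and `i + 1` is taken modulo `n + 1`. A loop is a cycle with one edge, and two parallel edges form a
cycle with two edges. -/
structure IsCycle {n : ℕ} (d : Fin (n + 1) → E × Bool) : Prop where
  joined : ∀ i, G.vertex (d i) = G.vertex ((d (i + 1)).1, !(d (i + 1)).2)
  edge_injective : Function.Injective fun i => (d i).1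
  vertex_injective : Function.Injective fun i => G.vertex (d i)

end Combinatorics

section Functions

/-- Functions on `G` are families `f : E → ℝ → ℂ`, of which only the values `f e x` with
`x ∈ edge e` matter. -/
def edge (e : E) : Set ℝ := Set.Icc 0 (G.length e)

/-- The derivative along each edge (one-sided at the endpoints). -/
noncomputable def edgeDeriv (f : E → ℝ → ℂ) : E → ℝ → ℂ :=
  fun e => derivWithin (f e) (G.edge e)

/-- The coordinate of an endpoint on its edge. -/
def coord (p : E × Bool) : ℝ := if p.2 then G.length p.1 else 0

/-- `f e` and its derivative are absolutely continuous, for each edge `e`. -/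
def IsAC2 (f : E → ℝ → ℂ) : Prop :=
  ∀ e, AbsolutelyContinuousOnInterval (f e) 0 (G.length e) ∧
    DifferentiableOn ℝ (f e) (G.edge e) ∧
    AbsolutelyContinuousOnInterval (G.edgeDeriv f e) 0 (G.length e)

/-- The values of `f` at endpoints belonging to the same vertex coincide. -/
def IsContinuousAtVertices (f : E → ℝ → ℂ) : Prop :=
  ∀ p q : E × Bool, G.vertex p = G.vertex q → f p.1 (G.coord p) = f q.1 (G.coord q)

/-- The value `f v` of a continuous function at a vertex, read off at an arbitrary endpoint. -/
noncomputable def vertexValue (f : E → ℝ → ℂ) (v : V) : ℂ :=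
  f (Function.surjInv G.vertex_surjective v).1 (G.coord (Function.surjInv G.vertex_surjective v))

open Classical in
/-- `∂_ν f (v)`: the sum of `f_e' (length e)` over the edges `e` terminating at `v`, minus the sum
of `f_e' (0)` over the edges `e` originating at `v`. -/
noncomputable def normalDeriv [Fintype E] (f : E → ℝ → ℂ) (v : V) : ℂ :=
  (∑ e with G.vertex (e, true) = v, G.edgeDeriv f e (G.length e)) -
    ∑ e with G.vertex (e, false) = v, G.edgeDeriv f e 0

/-- The Laplacian `(f_e)_e ↦ (- f_e'')_e`. -/
noncomputable def laplacian (f : E → ℝ → ℂ) : E → ℝ → ℂ :=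
  fun e x => - G.edgeDeriv (G.edgeDeriv f) e x

/-- Lebesgue measure on an edge. -/
noncomputable def edgeMeasure (e : E) : Measure ℝ := volume.restrict (G.edge e)

/-- `f` is square integrable on `G`. -/
def IsL2 (f : E → ℝ → ℂ) : Prop := ∀ e, MemLp (f e) 2 (G.edgeMeasure e)

/-- The Hilbert space `L² (G)`, the orthogonal sum of the spaces `L² (0, length e)`. -/
abbrev L2 : Type _ := PiLp 2 fun e : E => Lp ℂ 2 (G.edgeMeasure e)

section Linear

variable {G}

theorem IsAC2.edgeDeriv_add {f g : E → ℝ → ℂ} (hf : G.IsAC2 f) (hg : G.IsAC2 g) (e : E) :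
    ∀ x ∈ G.edge e, G.edgeDeriv (f + g) e x = G.edgeDeriv f e x + G.edgeDeriv g e x := by
  intro x hx
  exact derivWithin_add ((hf e).2.1 x hx) ((hg e).2.1 x hx)

theorem edgeDeriv_smul (c : ℂ) (f : E → ℝ → ℂ) :
    G.edgeDeriv (c • f) = c • G.edgeDeriv f := by
  funext e x
  exact derivWithin_const_smul_field c (f e)

theorem uIcc_eq_edge (e : E) : Set.uIcc 0 (G.length e) = G.edge e :=
  Set.uIcc_of_le (G.length_pos e).le

theorem coord_mem (p : E × Bool) : G.coord p ∈ G.edge p.1 := by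
  have := G.length_pos p.1
  unfold coord edge
  split_ifs <;> constructor <;> linarith

theorem left_mem (e : E) : (0 : ℝ) ∈ G.edge e := coord_mem (G := G) (e, false)

theorem right_mem (e : E) : G.length e ∈ G.edge e := coord_mem (G := G) (e, true)

theorem absolutelyContinuous_congr {f g : ℝ → ℂ} {a b : ℝ}
    (hf : AbsolutelyContinuousOnInterval f a b) (h : ∀ x ∈ Set.uIcc a b, f x = g x) :
    AbsolutelyContinuousOnInterval g a b := by
  rw [absolutelyContinuousOnInterval_iff] at hf ⊢
  intro ε hε
  obtain ⟨δ, hδ, H⟩ := hf ε hε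
  refine ⟨δ, hδ, fun I hI hlt => ?_⟩
  have := H I hI hlt
  convert this using 2 with i hi
  rw [h _ (hI.1 i hi).1, h _ (hI.1 i hi).2]

theorem IsAC2.add {f g : E → ℝ → ℂ} (hf : G.IsAC2 f) (hg : G.IsAC2 g) : G.IsAC2 (f + g) := by
  intro e
  refine ⟨(hf e).1.add (hg e).1, (hf e).2.1.add (hg e).2.1, ?_⟩
  refine absolutelyContinuous_congr ((hf e).2.2.add (hg e).2.2) fun x hx => ?_
  rw [uIcc_eq_edge] at hx
  exact (hf.edgeDeriv_add hg e x hx).symm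

theorem IsAC2.smul {f : E → ℝ → ℂ} (hf : G.IsAC2 f) (c : ℂ) : G.IsAC2 (c • f) := by
  intro e
  refine ⟨(hf e).1.const_smul c, (hf e).2.1.const_smul c, ?_⟩
  rw [edgeDeriv_smul]
  exact (hf e).2.2.const_smul c

theorem IsAC2.zero : G.IsAC2 0 := by
  have hc : ∀ e, AbsolutelyContinuousOnInterval (fun _ : ℝ => (0 : ℂ)) 0 (G.length e) := by
    intro e
    rw [absolutelyContinuousOnInterval_iff]
    intro ε hε
    exact ⟨1, one_pos, fun I _ _ => by simpa using hε⟩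
  intro e
  refine ⟨hc e, differentiableOn_const (0 : ℂ), ?_⟩
  have : G.edgeDeriv 0 e = fun _ => (0 : ℂ) := derivWithin_fun_const (G.edge e) (0 : ℂ)
  rw [this]
  exact hc e

theorem IsAC2.laplacian_add {f g : E → ℝ → ℂ} (hf : G.IsAC2 f) (hg : G.IsAC2 g) (e : E) :
    G.laplacian (f + g) e =ᵐ[G.edgeMeasure e] G.laplacian f e + G.laplacian g e := by
  have h1 : ∀ᵐ x ∂G.edgeMeasure e, x ∈ Set.uIcc 0 (G.length e) →
      DifferentiableAt ℝ (G.edgeDeriv f e) x :=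
    ae_restrict_of_ae (hf e).2.2.boundedVariationOn.ae_differentiableAt_of_mem_uIcc
  have h2 : ∀ᵐ x ∂G.edgeMeasure e, x ∈ Set.uIcc 0 (G.length e) →
      DifferentiableAt ℝ (G.edgeDeriv g e) x :=
    ae_restrict_of_ae (hg e).2.2.boundedVariationOn.ae_differentiableAt_of_mem_uIcc
  have h0 : ∀ᵐ x ∂G.edgeMeasure e, x ∈ G.edge e := ae_restrict_mem measurableSet_Icc
  filter_upwards [h1, h2, h0] with x hx1 hx2 hx
  have hx' : x ∈ Set.uIcc 0 (G.length e) := by rwa [uIcc_eq_edge]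
  have key : G.edgeDeriv (G.edgeDeriv (f + g)) e x =
      G.edgeDeriv (G.edgeDeriv f) e x + G.edgeDeriv (G.edgeDeriv g) e x := by
    have h3 : G.edgeDeriv (G.edgeDeriv (f + g)) e x =
        derivWithin (G.edgeDeriv f e + G.edgeDeriv g e) (G.edge e) x :=
      derivWithin_congr (fun y hy => hf.edgeDeriv_add hg e y hy) (hf.edgeDeriv_add hg e x hx)
    rw [h3]
    exact derivWithin_add (hx1 hx').differentiableWithinAt (hx2 hx').differentiableWithinAt
  simp only [laplacian, key, Pi.add_apply, neg_add]

theorem laplacian_smul (c : ℂ) (f : E → ℝ → ℂ) :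
    G.laplacian (c • f) = c • G.laplacian f := by
  funext e x
  simp [laplacian, edgeDeriv_smul]

theorem laplacian_zero : G.laplacian 0 = 0 := by
  simpa using laplacian_smul (G := G) 0 0

theorem IsAC2.normalDeriv_add [Fintype E] {f g : E → ℝ → ℂ} (hf : G.IsAC2 f) (hg : G.IsAC2 g)
    (v : V) : G.normalDeriv (f + g) v = G.normalDeriv f v + G.normalDeriv g v := by
  classical
  simp only [normalDeriv, hf.edgeDeriv_add hg _ _ (left_mem _),
    hf.edgeDeriv_add hg _ _ (right_mem _), Finset.sum_add_distrib]
  ring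

theorem normalDeriv_smul [Fintype E] (c : ℂ) (f : E → ℝ → ℂ) (v : V) :
    G.normalDeriv (c • f) v = c * G.normalDeriv f v := by
  classical
  simp only [normalDeriv, edgeDeriv_smul, Pi.smul_apply, smul_eq_mul, ← Finset.mul_sum]
  ring

theorem IsL2.laplacian_add {f g : E → ℝ → ℂ} (hf : G.IsAC2 f) (hg : G.IsAC2 g)
    (hf2 : G.IsL2 (G.laplacian f)) (hg2 : G.IsL2 (G.laplacian g)) :
    G.IsL2 (G.laplacian (f + g)) := fun e =>
  ((hf2 e).add (hg2 e)).ae_eq (hf.laplacian_add hg e).symm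

end Linear

/-- The functions (not classes of functions) in the domain of the Laplacian with `δ`-conditions of
strength `α`: `f` is in `L² (G)` and in `AC² (G)`, `- f''` is in `L² (G)`, `f` is continuous on `G`,
and `∂_ν f (v) - α v f (v) = 0` at each vertex `v`. -/
noncomputable def domainFun [Fintype E] (α : V → ℝ) : Submodule ℂ (E → ℝ → ℂ) where
  carrier := {f | G.IsL2 f ∧ G.IsAC2 f ∧ G.IsL2 (G.laplacian f) ∧ G.IsContinuousAtVertices f ∧
    ∀ v, G.normalDeriv f v - α v * G.vertexValue f v = 0}
  add_mem' := by
    rintro f g ⟨hf1, hf2, hf3, hf4, hf5⟩ ⟨hg1, hg2, hg3, hg4, hg5⟩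
    refine ⟨fun e => (hf1 e).add (hg1 e), hf2.add hg2, IsL2.laplacian_add hf2 hg2 hf3 hg3,
      fun p q h => ?_, fun v => ?_⟩
    · simp only [Pi.add_apply, hf4 p q h, hg4 p q h]
    · rw [hf2.normalDeriv_add hg2]
      have h1 := hf5 v
      have h2 := hg5 v
      have h3 : G.vertexValue (f + g) v = G.vertexValue f v + G.vertexValue g v := rfl
      rw [h3]
      linear_combination h1 + h2
  zero_mem' := by
    have hz : G.IsL2 0 := fun e => MemLp.zero
    refine ⟨hz, IsAC2.zero, by rwa [laplacian_zero], fun p q _ => rfl, fun v => ?_⟩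
    have h1 : G.normalDeriv 0 v = 0 := by
      simpa using normalDeriv_smul (G := G) 0 0 v
    have h2 : G.vertexValue 0 v = 0 := rfl
    simp [h1, h2]
  smul_mem' := by
    rintro c f ⟨hf1, hf2, hf3, hf4, hf5⟩
    refine ⟨fun e => (hf1 e).const_smul c, hf2.smul c, ?_, fun p q h => ?_, fun v => ?_⟩
    · rw [laplacian_smul]
      exact fun e => (hf3 e).const_smul c
    · simp only [Pi.smul_apply, hf4 p q h]
    · have h3 : G.vertexValue (c • f) v = c * G.vertexValue f v := rfl
      rw [normalDeriv_smul, h3]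
      linear_combination c * hf5 v

/-- A function in the domain, as an element of `L² (G)`. -/
noncomputable def domainClass [Fintype E] (α : V → ℝ) : G.domainFun α →ₗ[ℂ] G.L2 where
  toFun f := WithLp.toLp 2 fun e => (f.2.1 e).toLp (f.1 e)
  map_add' f g := by
    ext1 e
    exact MemLp.toLp_add (f.2.1 e) (g.2.1 e)
  map_smul' c f := by
    ext1 e
    exact MemLp.toLp_const_smul c (f.2.1 e)

/-- The class of `- f''` in `L² (G)`, for `f` in the domain. -/
noncomputable def laplacianClass [Fintype E] (α : V → ℝ) : G.domainFun α →ₗ[ℂ] G.L2 where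
  toFun f := WithLp.toLp 2 fun e => (f.2.2.2.1 e).toLp (G.laplacian f.1 e)
  map_add' f g := by
    ext1 e
    exact (MemLp.toLp_congr ((f + g).2.2.2.1 e) ((f.2.2.2.1 e).add (g.2.2.2.1 e))
      (f.2.2.1.laplacian_add g.2.2.1 e)).trans (MemLp.toLp_add (f.2.2.2.1 e) (g.2.2.2.1 e))
  map_smul' c f := by
    ext1 e
    refine (MemLp.toLp_congr ((c • f).2.2.2.1 e) ((f.2.2.2.1 e).const_smul c)
      (ae_of_all _ fun x => ?_)).trans (MemLp.toLp_const_smul c (f.2.2.2.1 e))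
    change G.laplacian (c • f.1) e x = _
    rw [laplacian_smul]
    rfl

/-- The operator `A_α` in `L² (G)`: it maps the class of `f` to the class of `- f''`, for `f` in
`domainFun α`. It is given by its graph; see `deltaLaplacian_graph`. -/
noncomputable def deltaLaplacian [Fintype E] (α : V → ℝ) : G.L2 →ₗ.[ℂ] G.L2 :=
  (LinearMap.range ((G.domainClass α).prod (G.laplacianClass α))).toLinearPMap

theorem deltaLaplacian_graph [Fintype E] (α : V → ℝ) :
    (G.deltaLaplacian α).graph =
      LinearMap.range ((G.domainClass α).prod (G.laplacianClass α)) := by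
  refine Submodule.toLinearPMap_graph_eq _ ?_
  rintro _ ⟨f, rfl⟩ h0
  have h0' : G.domainClass α f = 0 := h0
  change G.laplacianClass α f = 0
  have hzero : ∀ e, ∀ x ∈ G.edge e, f.1 e x = 0 := by
    intro e
    have h1 : (f.2.1 e).toLp (f.1 e) = 0 := congrArg (fun u : G.L2 => u e) h0'
    have h2 : f.1 e =ᵐ[volume.restrict (Set.Icc 0 (G.length e))] fun _ => (0 : ℂ) :=
      (MemLp.coeFn_toLp (f.2.1 e)).symm.trans (by rw [h1]; exact Lp.coeFn_zero _ _ _)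
    have hcont : ContinuousOn (f.1 e) (Set.Icc 0 (G.length e)) := by
      have := (f.2.2.1 e).2.1.continuousOn
      exact this
    exact Measure.eqOn_Icc_of_ae_eq volume (G.length_pos e).ne h2 hcont continuousOn_const
  have hzero' : ∀ e, ∀ x ∈ G.edge e, G.edgeDeriv f.1 e x = 0 := by
    intro e x hx
    have : G.edgeDeriv f.1 e x = derivWithin (fun _ => (0 : ℂ)) (G.edge e) x :=
      derivWithin_congr (hzero e) (hzero e x hx)
    rw [this, derivWithin_fun_const]
    rfl
  ext1 e
  change (f.2.2.2.1 e).toLp (G.laplacian f.1 e) = 0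
  have hae : G.laplacian f.1 e =ᵐ[G.edgeMeasure e] 0 := by
    have h0 : ∀ᵐ x ∂G.edgeMeasure e, x ∈ G.edge e := ae_restrict_mem measurableSet_Icc
    filter_upwards [h0] with x hx
    have : G.edgeDeriv (G.edgeDeriv f.1) e x = derivWithin (fun _ => (0 : ℂ)) (G.edge e) x :=
      derivWithin_congr (hzero' e) (hzero' e x hx)
    simp [laplacian, this]
  exact (MemLp.toLp_congr (f.2.2.2.1 e) MemLp.zero hae).trans (MemLp.toLp_zero _)

/-- `f` is in `L² (G)` and in `AC² (G)`, solves `- f'' = μ f`, is continuous on `G`, and satisfies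
`∂_ν f (v) - α v f (v) = h v` at each vertex `v`. -/
def IsSolution [Fintype E] (α : V → ℝ) (μ : ℂ) (h : V → ℂ) (f : E → ℝ → ℂ) : Prop :=
  G.IsL2 f ∧ G.IsAC2 f ∧ (∀ e, ∀ᵐ x ∂G.edgeMeasure e, G.laplacian f e x = μ * f e x) ∧
    G.IsContinuousAtVertices f ∧ ∀ v, G.normalDeriv f v - α v * G.vertexValue f v = h v

open Classical in
/-- The solution `f` of `- f'' = μ f` with `∂_ν f - α f` equal to `1` at `l` and to `0` at all other
vertices. For `μ` in the resolvent set of `A_α` it exists and is unique on `G`. -/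
noncomputable def fundamentalSolution [Fintype E] (α : V → ℝ) (μ : ℂ) (l : V) : E → ℝ → ℂ :=
  if h : ∃ f, G.IsSolution α μ (fun v => if v = l then 1 else 0) f then h.choose else 0

/-- The Titchmarsh–Weyl function `M_{B,α}`. It is to be considered on the resolvent set of `A_α`;
its values at other points have no meaning and are never used. -/
noncomputable def titchmarshWeyl [Fintype E] (B : Finset V) (α : V → ℝ) (μ : ℂ) : Matrix B B ℂ :=
  Matrix.of fun k l => G.vertexValue (G.fundamentalSolution α μ l) k

end Functions

end MetricGraph

namespace UnboundedOperator

variable {H : Type*} [NormedAddCommGroup H] [NormedSpace ℂ H]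

/-- The resolvent set of an unbounded operator: the `z` for which `A - z` is a bijection from the
domain onto `H` with bounded inverse. Its complement is the spectrum. -/
def resolventSet (A : H →ₗ.[ℂ] H) : Set ℂ :=
  {z | ∃ T : H →L[ℂ] H, (∀ u, ∃ h : T u ∈ A.domain, A ⟨T u, h⟩ - z • T u = u) ∧
    ∀ u : A.domain, T (A u - z • (u : H)) = u}

/-- The space `ker (A - z)`. -/
def eigenspace (A : H →ₗ.[ℂ] H) (z : ℂ) : Submodule ℂ H :=
  (LinearMap.ker (A.toFun - z • A.domain.subtype)).map A.domain.subtype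

theorem mem_eigenspace (A : H →ₗ.[ℂ] H) (z : ℂ) (u : H) :
    u ∈ eigenspace A z ↔ ∃ h : u ∈ A.domain, A ⟨u, h⟩ = z • u := by
  simp only [eigenspace, Submodule.mem_map, LinearMap.mem_ker, LinearMap.sub_apply, sub_eq_zero]
  constructor
  · rintro ⟨w, hw, rfl⟩
    exact ⟨w.2, hw⟩
  · rintro ⟨h, hu⟩
    exact ⟨⟨u, h⟩, hu, rfl⟩

/-- `z` is an eigenvalue of `A`. -/
def IsEigenvalue (A : H →ₗ.[ℂ] H) (z : ℂ) : Prop := eigenspace A z ≠ ⊥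

end UnboundedOperator

namespace MatrixFunction

variable {ι : Type*}

/-- `z₀` is a pole of order `n` of the matrix function `R` with domain `D`: on a punctured
neighbourhood of `z₀` contained in `D` the function `R` is analytic, and `(z - z₀) ^ n • R z` has a
nonzero limit at `z₀`. -/
def IsPoleOfOrder (D : Set ℂ) (R : ℂ → Matrix ι ι ℂ) (z₀ : ℂ) (n : ℕ) : Prop :=
  (∃ U : Set ℂ, IsOpen U ∧ z₀ ∈ U ∧ closure U \ {z₀} ⊆ D ∧
    ∀ i j, AnalyticOnNhd ℂ (fun z => R z i j) (U \ {z₀})) ∧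
  ∃ L : Matrix ι ι ℂ, L ≠ 0 ∧ Tendsto (fun z => (z - z₀) ^ n • R z) (𝓝[≠] z₀) (𝓝 L)

/-- `z₀` is a pole (of positive order) of `R`. -/
def IsPole (D : Set ℂ) (R : ℂ → Matrix ι ι ℂ) (z₀ : ℂ) : Prop :=
  ∃ n, 1 ≤ n ∧ IsPoleOfOrder D R z₀ n

/-- The residue at an isolated singularity `z₀`: the value, for all sufficiently small `r > 0`, of
`(2 π i)⁻¹ ∮ R (z) dz` over the circle with centre `z₀` and radius `r`. -/
noncomputable def residue (R : ℂ → Matrix ι ι ℂ) (z₀ : ℂ) : Matrix ι ι ℂ :=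
  Matrix.of fun i j =>
    limUnder (𝓝[>] (0 : ℝ)) fun r =>
      (2 * Real.pi * Complex.I)⁻¹ * ∮ z in C(z₀, r), R z i j

end MatrixFunction

/-!
# Eigenvalues of a graph Laplacian and poles of a partial Titchmarsh–Weyl function

Write `A` for `G.deltaLaplacian α`, `K` for its eigenspace at `lam`, `P` for the orthogonal
projection onto `K` and `M` for `G.titchmarshWeyl B α`.

*The resolvent.* Green's identity on the graph shows that `A` is symmetric. On each edge the
equation `-f'' = lam f + g` is solved by variation of constants, so `A u - lam u = z` reduces to
finite-dimensional linear algebra with the values and outward derivatives at the endpoints. There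
both the vertex conditions and the boundary data of solutions of `-f'' = lam f` contain their
orthogonal complements with respect to the boundary form of Green's identity, and this gives
solvability whenever `z` is orthogonal to `K` (`exists_deltaLaplacian_sub_smul_eq`). Hence `A - lam`
has an inverse on the orthogonal complement of `K`; it is symmetric and everywhere defined, so it is
bounded by the Hellinger–Toeplitz theorem. A Neumann series then shows that a punctured
neighbourhood of `lam` lies in the resolvent set and that the resolvent is
`- (z - lam)⁻¹ • P` plus an analytic function (`exists_resolvent_expansion`).

*The residue.* For each vertex `l` take a function `w l`, a cubic polynomial on each edge, that
vanishes at all vertices and satisfies `∂_ν (w l) - α (w l) = 1` at `l` and `= 0` elsewhere. Green's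
identity with `w k` expresses the value at `k` of a function in the domain through inner products,
and correcting `w l` by the resolvent produces the fundamental solutions. Thus the entries of `M`
are inner products with the resolvent (`titchmarshWeyl_apply`), so that `(z - lam) M(z)` is analytic
near `lam`, and its value at `lam`, the residue, is minus the Gram matrix of the vectors `P (y l)`,
where `y l = - (w l)'' - lam w l`. As `⟨y l, u⟩ = - u(l)` for `u` in `K`, the rank of the
residue is the dimension of `K` as soon as an eigenfunction vanishing on `B` is zero
(`rank_gram_starProjection`).

*Unique continuation* (`HasDefect.eqOn_zero`). Let `f` be an eigenfunction vanishing on `B`, and let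
`S` be the set of edges on which `f` is not identically zero. At a vertex of degree one in `S` both
`f` and its derivative along the edge of `S` would vanish, so `S` has no such vertex and is
contained in the core; consequently `f` vanishes at all vertices. On the edges of `S` it is then
a multiple of the solution vanishing at `0`, whose positive zeros are commensurable, so all
edges of `S` have commensurable lengths. If `S` were nonempty it would contain a cycle,
contradicting the hypothesis on cycles.
-/

open scoped ComplexConjugate

/-! ### Absolutely continuous functions on an interval -/

namespace AbsolutelyContinuousOnInterval

variable {a b : ℝ}

theorem congr_on {f g : ℝ → ℂ} (hf : AbsolutelyContinuousOnInterval f a b)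
    (h : ∀ x ∈ Set.uIcc a b, f x = g x) : AbsolutelyContinuousOnInterval g a b :=
  MetricGraph.absolutelyContinuous_congr hf h

/-- Mathlib has this for real-valued functions. -/
theorem primitive {f : ℝ → ℂ} (h : IntervalIntegrable f volume a b) :
    AbsolutelyContinuousOnInterval (fun x => ∫ t in a..x, f t) a b := by
  have hsub : ∀ x ∈ uIcc a b, IntervalIntegrable f volume a x := fun x hx =>
    h.mono_set (uIcc_subset_uIcc left_mem_uIcc hx)
  have hre : IntervalIntegrable (fun t => (f t).re) volume a b := ⟨h.1.re, h.2.re⟩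
  have him : IntervalIntegrable (fun t => (f t).im) volume a b := ⟨h.1.im, h.2.im⟩
  have h1 := hre.absolutelyContinuousOnInterval_intervalIntegral (c := a) left_mem_uIcc
  have h2 := him.absolutelyContinuousOnInterval_intervalIntegral (c := a) left_mem_uIcc
  have hc : ∀ c : ℂ, AbsolutelyContinuousOnInterval (fun _ : ℝ => c) a b := fun c =>
    contDiffOn_const.absolutelyContinuousOnInterval
  refine congr_on ((h1.smul (hc 1)).add (h2.smul (hc Complex.I))) fun x hx => ?_
  have e1 := Complex.reCLM.intervalIntegral_comp_comm (hsub x hx)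
  have e2 := Complex.imCLM.intervalIntegral_comp_comm (hsub x hx)
  simp only [Complex.reCLM_apply, Complex.imCLM_apply] at e1 e2
  simp [e1, e2, Complex.re_add_im]

/-- The fundamental theorem of calculus for complex-valued absolutely continuous functions. -/
theorem integral_eq_sub {f f' : ℝ → ℂ} (hf : AbsolutelyContinuousOnInterval f a b)
    (hd : ∀ᵐ x, x ∈ uIcc a b → HasDerivAt f (f' x) x) (hi : IntervalIntegrable f' volume a b) :
    ∫ x in a..b, f' x = f b - f a := by
  have hg := hf.sub (primitive hi)
  obtain ⟨c, hc⟩ := hg.const_of_ae_hasDerivAt_zero (by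
    filter_upwards [hd, hi.ae_hasDerivAt_integral] with x h1 h2 hx
    simpa using (h1 hx).sub (h2 hx a left_mem_uIcc))
  have ha := hc a left_mem_uIcc
  have hb := hc b right_mem_uIcc
  simp only [Pi.sub_apply, intervalIntegral.integral_same, sub_zero] at ha hb
  rw [ha, ← hb]
  ring

theorem eq_left_of_ae_hasDerivAt_zero {f : ℝ → ℂ} (hf : AbsolutelyContinuousOnInterval f a b)
    (hd : ∀ᵐ x, x ∈ uIcc a b → HasDerivAt f 0 x) {x : ℝ} (hx : x ∈ uIcc a b) : f x = f a := by
  obtain ⟨c, hc⟩ := hf.const_of_ae_hasDerivAt_zero hd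
  rw [hc x hx, hc a left_mem_uIcc]

/-- An absolutely continuous function whose derivative agrees almost everywhere with a continuous
function is continuously differentiable. -/
theorem hasDerivWithinAt_of_continuousOn {f h : ℝ → ℂ} (hab : a < b)
    (hf : AbsolutelyContinuousOnInterval f a b)
    (hd : ∀ᵐ x, x ∈ uIcc a b → HasDerivAt f (h x) x) (hh : ContinuousOn h (Icc a b))
    {x : ℝ} (hx : x ∈ Icc a b) : HasDerivWithinAt f (h x) (Icc a b) x := by
  have hu : uIcc a b = Icc a b := uIcc_of_le hab.le
  have hi : IntervalIntegrable h volume a b := by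
    apply ContinuousOn.intervalIntegrable; rwa [hu]
  have key : ∀ y ∈ Icc a b, f y = f a + ∫ t in a..y, h t := by
    intro y hy
    have hsub : uIcc a y ⊆ uIcc a b := uIcc_subset_uIcc left_mem_uIcc (by rwa [hu])
    rw [(hf.mono hsub).integral_eq_sub (hd.mono fun z hz hz' => hz (hsub hz')) (hi.mono_set hsub)]
    ring
  have : Fact (x ∈ Icc a b) := ⟨hx⟩
  have hsub : uIcc a x ⊆ uIcc a b := uIcc_subset_uIcc left_mem_uIcc (by rwa [hu])
  have h1 : HasDerivWithinAt (fun y => ∫ t in a..y, h t) (h x) (Icc a b) x := by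
    refine intervalIntegral.integral_hasDerivWithinAt_right (hi.mono_set hsub) ?_ (hh x hx)
    exact ⟨Icc a b, self_mem_nhdsWithin, hh.aestronglyMeasurable measurableSet_Icc⟩
  exact (h1.const_add (f a)).congr key (key x hx)

end AbsolutelyContinuousOnInterval

theorem absolutelyContinuousOnInterval_of_hasDerivAt {f f' : ℝ → ℂ} (a b : ℝ)
    (h : ∀ x, HasDerivAt f (f' x) x) (hc : Continuous f') :
    AbsolutelyContinuousOnInterval f a b := by
  refine (ContDiff.contDiffOn ?_).absolutelyContinuousOnInterval
  rw [contDiff_one_iff_deriv]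
  refine ⟨fun x => (h x).differentiableAt, ?_⟩
  rwa [funext fun x => (h x).deriv]

/-- `F` is a solution of `F'' = F₂` on `[0, L]` in the sense of Carathéodory, with derivative `F₁`:
`F` and `F₁` are absolutely continuous, and `F' = F₁`, `F₁' = F₂` almost everywhere. -/
structure IsSecondPrimitive (L : ℝ) (F F₁ F₂ : ℝ → ℂ) : Prop where
  ac : AbsolutelyContinuousOnInterval F 0 L
  ac' : AbsolutelyContinuousOnInterval F₁ 0 L
  deriv : ∀ᵐ x, x ∈ uIcc 0 L → HasDerivAt F (F₁ x) x
  deriv' : ∀ᵐ x, x ∈ uIcc 0 L → HasDerivAt F₁ (F₂ x) x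

namespace IsSecondPrimitive

variable {L : ℝ} {F F₁ F₂ U U₁ U₂ : ℝ → ℂ}

theorem of_hasDerivAt (h : ∀ x, HasDerivAt F (F₁ x) x) (h' : ∀ x, HasDerivAt F₁ (F₂ x) x)
    (hc : Continuous F₂) : IsSecondPrimitive L F F₁ F₂ where
  ac := absolutelyContinuousOnInterval_of_hasDerivAt _ _ h
    (continuous_iff_continuousAt.2 fun x => (h' x).continuousAt)
  ac' := absolutelyContinuousOnInterval_of_hasDerivAt _ _ h' hc
  deriv := ae_of_all _ fun x _ => h x
  deriv' := ae_of_all _ fun x _ => h' x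

theorem hasDerivWithinAt (hL : 0 < L) (hF : IsSecondPrimitive L F F₁ F₂) {x : ℝ}
    (hx : x ∈ Icc 0 L) : HasDerivWithinAt F (F₁ x) (Icc 0 L) x := by
  refine hF.ac.hasDerivWithinAt_of_continuousOn hL hF.deriv ?_ hx
  simpa [uIcc_of_le hL.le] using hF.ac'.continuousOn

/-- Green's identity on an interval. -/
theorem green (hF : IsSecondPrimitive L F F₁ F₂) (hU : IsSecondPrimitive L U U₁ U₂)
    (hF2 : IntervalIntegrable F₂ volume 0 L) (hU2 : IntervalIntegrable U₂ volume 0 L) :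
    ∫ x in (0 : ℝ)..L, (F₂ x * conj (U x) - F x * conj (U₂ x)) =
      (F₁ L * conj (U L) - F L * conj (U₁ L)) - (F₁ 0 * conj (U 0) - F 0 * conj (U₁ 0)) := by
  have hstar : ∀ {g : ℝ → ℂ}, AbsolutelyContinuousOnInterval g 0 L →
      AbsolutelyContinuousOnInterval (fun x => conj (g x)) 0 L := by
    intro g hg
    simpa only [AbsolutelyContinuousOnInterval, Complex.isometry_conj.dist_eq] using hg
  refine AbsolutelyContinuousOnInterval.integral_eq_sub
    (f := fun x => F₁ x * conj (U x) - F x * conj (U₁ x)) ?_ ?_ ?_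
  · exact (hF.ac'.smul (hstar hU.ac)).sub (hF.ac.smul (hstar hU.ac'))
  · filter_upwards [hF.deriv, hF.deriv', hU.deriv, hU.deriv'] with x h1 h2 h3 h4 hx
    have := ((h2 hx).mul (h3 hx).star).sub ((h1 hx).mul (h4 hx).star)
    refine this.congr_deriv ?_
    simp only [← starRingEnd_apply]
    ring
  · refine (hF2.mul_continuousOn (hstar hU.ac).continuousOn).sub ?_
    refine IntervalIntegrable.continuousOn_mul ?_ hF.ac.continuousOn
    exact ⟨Complex.conjCLE.toContinuousLinearMap.integrable_comp hU2.1,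
      Complex.conjCLE.toContinuousLinearMap.integrable_comp hU2.2⟩

end IsSecondPrimitive

/-! ### The equation `-f'' = λ f + g` on an interval -/

/-- A real fundamental system of `-f'' = lam f`: `S` and `C = S'` are the solutions with
`S 0 = 0`, `S' 0 = 1` and `C 0 = 1`, `C' 0 = 0`. -/
structure IsFundamentalSystem (lam : ℝ) (C S : ℝ → ℝ) : Prop where
  C_zero : C 0 = 1
  S_zero : S 0 = 0
  hasDerivAt_C : ∀ x, HasDerivAt C (-lam * S x) x
  hasDerivAt_S : ∀ x, HasDerivAt S (C x) x
  wronskian : ∀ x, C x ^ 2 + lam * S x ^ 2 = 1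
  /-- Positive zeros of `S` are commensurable. -/
  zeros : ∀ x y, 0 < x → 0 < y → S x = 0 → S y = 0 → ∃ m n : ℤ, m ≠ 0 ∧ m * x = n * y

/-- The system is given by hyperbolic functions, by `1` and `x`, or by trigonometric functions,
according to the sign of `lam`; only in the last case does `S` have positive zeros. -/
theorem exists_isFundamentalSystem (lam : ℝ) : ∃ C S, IsFundamentalSystem lam C S := by
  rcases lt_trichotomy lam 0 with h | rfl | h
  · obtain ⟨w, hw, rfl⟩ : ∃ w : ℝ, 0 < w ∧ lam = -w ^ 2 :=
      ⟨√(-lam), Real.sqrt_pos.2 (by linarith), by rw [Real.sq_sqrt (by linarith)]; ring⟩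
    have hm : ∀ x : ℝ, HasDerivAt (fun x => w * x) w x := fun x => by
      simpa using (hasDerivAt_id x).const_mul w
    refine ⟨fun x => Real.cosh (w * x), fun x => Real.sinh (w * x) / w, by simp, by simp,
      fun x => ?_, fun x => ?_, fun x => ?_, fun x y hx _ h0 => ?_⟩
    · refine (hm x).cosh.congr_deriv ?_
      field_simp
    · refine ((hm x).sinh.div_const w).congr_deriv ?_
      field_simp
    · have := Real.cosh_sq (w * x)
      field_simp
      linarith
    · have : Real.sinh (w * x) = 0 := by simpa [hw.ne'] using h0
      rw [Real.sinh_eq_zero] at this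
      exact absurd this (by positivity)
  · refine ⟨fun _ => 1, fun x => x, rfl, rfl, fun x => ?_, fun x => hasDerivAt_id x,
      fun x => by simp, fun x y hx _ h0 => absurd h0 hx.ne'⟩
    simpa using hasDerivAt_const x (1 : ℝ)
  · obtain ⟨w, hw, rfl⟩ : ∃ w : ℝ, 0 < w ∧ lam = w ^ 2 :=
      ⟨√lam, Real.sqrt_pos.2 h, by rw [Real.sq_sqrt h.le]⟩
    have hm : ∀ x : ℝ, HasDerivAt (fun x => w * x) w x := fun x => by
      simpa using (hasDerivAt_id x).const_mul w
    refine ⟨fun x => Real.cos (w * x), fun x => Real.sin (w * x) / w, by simp, by simp,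
      fun x => ?_, fun x => ?_, fun x => ?_, fun x y hx hy h0 h1 => ?_⟩
    · refine (hm x).cos.congr_deriv ?_
      field_simp
    · refine ((hm x).sin.div_const w).congr_deriv ?_
      field_simp
    · have := Real.cos_sq_add_sin_sq (w * x)
      field_simp
      linarith
    · have h0' : Real.sin (w * x) = 0 := by simpa [hw.ne'] using h0
      have h1' : Real.sin (w * y) = 0 := by simpa [hw.ne'] using h1
      obtain ⟨m, hm⟩ := Real.sin_eq_zero_iff.1 h0'
      obtain ⟨n, hn⟩ := Real.sin_eq_zero_iff.1 h1'
      refine ⟨n, m, ?_, ?_⟩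
      · rintro rfl
        have : 0 < w * y := by positivity
        simp at hn
        rcases hn with hn | hn <;> linarith
      · apply mul_left_cancel₀ (mul_pos hw Real.pi_pos).ne'
        linear_combination (w * x) * hn - (w * y) * hm

namespace IsFundamentalSystem

variable {lam : ℝ} {C S : ℝ → ℝ}

theorem hasDerivAt_ofReal_C (h : IsFundamentalSystem lam C S) (x : ℝ) :
    HasDerivAt (fun x => (C x : ℂ)) (-(lam : ℂ) * (S x : ℂ)) x := by
  simpa using (h.hasDerivAt_C x).ofReal_comp

theorem hasDerivAt_ofReal_S (h : IsFundamentalSystem lam C S) (x : ℝ) :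
    HasDerivAt (fun x => (S x : ℂ)) (C x : ℂ) x :=
  (h.hasDerivAt_S x).ofReal_comp

theorem wronskian_ofReal (h : IsFundamentalSystem lam C S) (x : ℝ) :
    (C x : ℂ) ^ 2 + lam * (S x : ℂ) ^ 2 = 1 :=
  mod_cast h.wronskian x

theorem continuous_C (h : IsFundamentalSystem lam C S) : Continuous C :=
  continuous_iff_continuousAt.2 fun x => (h.hasDerivAt_C x).continuousAt

theorem continuous_S (h : IsFundamentalSystem lam C S) : Continuous S :=
  continuous_iff_continuousAt.2 fun x => (h.hasDerivAt_S x).continuousAt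

/-- The solution with initial values `a`, `b`. -/
theorem isSecondPrimitive (h : IsFundamentalSystem lam C S) (L : ℝ) (a b : ℂ) :
    IsSecondPrimitive L (fun x => a * C x + b * S x) (fun x => -lam * a * S x + b * C x)
      (fun x => -lam * (a * C x + b * S x)) := by
  have := h.continuous_C
  have := h.continuous_S
  refine .of_hasDerivAt (fun x => ?_) (fun x => ?_) (by fun_prop)
  · refine (((h.hasDerivAt_ofReal_C x).const_mul a).add
      ((h.hasDerivAt_ofReal_S x).const_mul b)).congr_deriv ?_
    ring
  · refine (((h.hasDerivAt_ofReal_S x).const_mul (-lam * a)).add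
      ((h.hasDerivAt_ofReal_C x).const_mul b)).congr_deriv ?_
    ring

/-- Every solution of `-F'' = lam F` is the combination of `C` and `S` with its initial values. -/
theorem eq_of_ae_eq (h : IsFundamentalSystem lam C S) {L : ℝ} {F F₁ F₂ : ℝ → ℂ}
    (hF : IsSecondPrimitive L F F₁ F₂)
    (hode : ∀ᵐ x, x ∈ uIcc 0 L → F₂ x = -lam * F x) {x : ℝ} (hx : x ∈ uIcc 0 L) :
    F x = F 0 * C x + F₁ 0 * S x ∧ F₁ x = -lam * F 0 * S x + F₁ 0 * C x := by
  have hac : ∀ y : ℂ, AbsolutelyContinuousOnInterval (fun x => y * (C x : ℂ)) 0 L := fun y =>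
    absolutelyContinuousOnInterval_of_hasDerivAt _ _
      (fun x => (h.hasDerivAt_ofReal_C x).const_mul y)
      (by have := h.continuous_S; fun_prop)
  have has : ∀ y : ℂ, AbsolutelyContinuousOnInterval (fun x => y * (S x : ℂ)) 0 L := fun y =>
    absolutelyContinuousOnInterval_of_hasDerivAt _ _
      (fun x => (h.hasDerivAt_ofReal_S x).const_mul y)
      (by have := h.continuous_C; fun_prop)
  -- The two Wronskians of `F` with `S` and `C` are constant.
  have e1 := (((hac 1).smul hF.ac).sub ((has 1).smul hF.ac')).eq_left_of_ae_hasDerivAt_zero (by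
    filter_upwards [hF.deriv, hF.deriv', hode] with x h1 h2 h3 hx
    refine ((((h.hasDerivAt_ofReal_C x).const_mul 1).mul (h1 hx)).sub
      (((h.hasDerivAt_ofReal_S x).const_mul 1).mul (h2 hx))).congr_deriv ?_
    rw [h3 hx]
    ring) hx
  have e2 := (((has lam).smul hF.ac).add ((hac 1).smul hF.ac')).eq_left_of_ae_hasDerivAt_zero (by
    filter_upwards [hF.deriv, hF.deriv', hode] with x h1 h2 h3 hx
    refine ((((h.hasDerivAt_ofReal_S x).const_mul (lam : ℂ)).mul (h1 hx)).add
      (((h.hasDerivAt_ofReal_C x).const_mul 1).mul (h2 hx))).congr_deriv ?_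
    rw [h3 hx]
    ring) hx
  simp only [Pi.sub_apply, Pi.add_apply, Pi.mul_apply, smul_eq_mul, h.C_zero, h.S_zero,
    Complex.ofReal_one, Complex.ofReal_zero] at e1 e2
  have hw := h.wronskian_ofReal x
  constructor
  · linear_combination (C x : ℂ) * e1 + (S x : ℂ) * e2 - F x * hw
  · linear_combination -(lam : ℂ) * (S x : ℂ) * e1 + (C x : ℂ) * e2 - F₁ x * hw

/-- Variation of constants: the inhomogeneous equation `-F'' = lam F + g` is solvable. -/
theorem exists_particular (h : IsFundamentalSystem lam C S) {L : ℝ} {g : ℝ → ℂ}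
    (hg : IntervalIntegrable g volume 0 L) :
    ∃ F F₁ : ℝ → ℂ, IsSecondPrimitive L F F₁ (fun x => -lam * F x - g x) := by
  have hC := h.continuous_C
  have hS := h.continuous_S
  have hcg : IntervalIntegrable (fun x => (C x : ℂ) * g x) volume 0 L :=
    hg.continuousOn_mul (by fun_prop)
  have hsg : IntervalIntegrable (fun x => (S x : ℂ) * g x) volume 0 L :=
    hg.continuousOn_mul (by fun_prop)
  have hac : ∀ y : ℂ, AbsolutelyContinuousOnInterval (fun x => y * (C x : ℂ)) 0 L := fun y =>
    absolutelyContinuousOnInterval_of_hasDerivAt _ _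
      (fun x => (h.hasDerivAt_ofReal_C x).const_mul y) (by fun_prop)
  have has : ∀ y : ℂ, AbsolutelyContinuousOnInterval (fun x => y * (S x : ℂ)) 0 L := fun y =>
    absolutelyContinuousOnInterval_of_hasDerivAt _ _
      (fun x => (h.hasDerivAt_ofReal_S x).const_mul y) (by fun_prop)
  have hpc := AbsolutelyContinuousOnInterval.primitive hcg
  have hps := AbsolutelyContinuousOnInterval.primitive hsg
  refine ⟨fun x => (-1 * (S x : ℂ)) • (∫ t in (0 : ℝ)..x, (C t : ℂ) * g t)
      + (1 * (C x : ℂ)) • ∫ t in (0 : ℝ)..x, (S t : ℂ) * g t,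
    fun x => (-1 * (C x : ℂ)) • (∫ t in (0 : ℝ)..x, (C t : ℂ) * g t)
      + (-lam * (S x : ℂ)) • ∫ t in (0 : ℝ)..x, (S t : ℂ) * g t,
    ⟨((has (-1)).smul hpc).add ((hac 1).smul hps),
      ((hac (-1)).smul hpc).add ((has (-lam)).smul hps), ?_, ?_⟩⟩
  · filter_upwards [hcg.ae_hasDerivAt_integral, hsg.ae_hasDerivAt_integral] with x h1 h2 hx
    refine ((((h.hasDerivAt_ofReal_S x).const_mul (-1)).mul (h1 hx 0 left_mem_uIcc)).add
      (((h.hasDerivAt_ofReal_C x).const_mul 1).mul (h2 hx 0 left_mem_uIcc))).congr_deriv ?_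
    simp only [smul_eq_mul]
    ring
  · filter_upwards [hcg.ae_hasDerivAt_integral, hsg.ae_hasDerivAt_integral] with x h1 h2 hx
    refine ((((h.hasDerivAt_ofReal_C x).const_mul (-1)).mul (h1 hx 0 left_mem_uIcc)).add
      (((h.hasDerivAt_ofReal_S x).const_mul (-(lam : ℂ))).mul
        (h2 hx 0 left_mem_uIcc))).congr_deriv ?_
    simp only [smul_eq_mul]
    linear_combination -g x * h.wronskian_ofReal x

end IsFundamentalSystem

/-! ### Traces at the endpoints and Green's identity on the graph -/

namespace MetricGraph

variable {V E : Type*} {G : MetricGraph V E}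

/-- At interior points of an edge the one-sided derivatives of `edgeDeriv` are derivatives. -/
theorem IsAC2.isSecondPrimitive {f : E → ℝ → ℂ} (hf : G.IsAC2 f) (e : E) :
    IsSecondPrimitive (G.length e) (f e) (G.edgeDeriv f e) (G.edgeDeriv (G.edgeDeriv f) e) := by
  have hae : ∀ᵐ x : ℝ, x ≠ 0 ∧ x ≠ G.length e := by
    filter_upwards [compl_mem_ae_iff.2 (measure_singleton (0 : ℝ)),
      compl_mem_ae_iff.2 (measure_singleton (G.length e))] with x h1 h2 using ⟨h1, h2⟩
  have hint : ∀ x ∈ uIcc 0 (G.length e), x ≠ 0 ∧ x ≠ G.length e → G.edge e ∈ 𝓝 x := by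
    intro x hx hne
    rw [uIcc_eq_edge] at hx
    exact Icc_mem_nhds (lt_of_le_of_ne hx.1 hne.1.symm) (lt_of_le_of_ne hx.2 hne.2)
  refine ⟨(hf e).1, (hf e).2.2, ?_, ?_⟩
  · filter_upwards [hae] with x hne hx
    have hx' : x ∈ G.edge e := by rwa [← uIcc_eq_edge]
    exact ((hf e).2.1 x hx').hasDerivWithinAt.hasDerivAt (hint x hx hne)
  · filter_upwards [hae, (hf e).2.2.boundedVariationOn.ae_differentiableAt_of_mem_uIcc]
      with x hne h hx
    exact (h hx).differentiableWithinAt.hasDerivWithinAt.hasDerivAt (hint x hx hne)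

section OfSecondPrimitive

variable {F F₁ F₂ : E → ℝ → ℂ}

theorem edgeDeriv_of_isSecondPrimitive
    (h : ∀ e, IsSecondPrimitive (G.length e) (F e) (F₁ e) (F₂ e)) {e : E} {x : ℝ}
    (hx : x ∈ G.edge e) : G.edgeDeriv F e x = F₁ e x :=
  ((h e).hasDerivWithinAt (G.length_pos e) hx).derivWithin
    (uniqueDiffOn_Icc (G.length_pos e) x hx)

theorem isAC2_of_isSecondPrimitive
    (h : ∀ e, IsSecondPrimitive (G.length e) (F e) (F₁ e) (F₂ e)) : G.IsAC2 F := by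
  refine fun e => ⟨(h e).ac, fun x hx => ?_, (h e).ac'.congr_on fun x hx => ?_⟩
  · exact ((h e).hasDerivWithinAt (G.length_pos e) hx).differentiableWithinAt
  · rw [uIcc_eq_edge] at hx
    exact (edgeDeriv_of_isSecondPrimitive h hx).symm

theorem ae_mem_edge (e : E) : ∀ᵐ x ∂G.edgeMeasure e, x ∈ G.edge e :=
  ae_restrict_mem measurableSet_Icc

theorem laplacian_of_isSecondPrimitive
    (h : ∀ e, IsSecondPrimitive (G.length e) (F e) (F₁ e) (F₂ e)) (e : E) :
    G.laplacian F e =ᵐ[G.edgeMeasure e] fun x => - F₂ e x := by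
  filter_upwards [ae_mem_edge e, ae_restrict_of_ae (h e).deriv'] with x hx hd
  have h1 : G.edgeDeriv (G.edgeDeriv F) e x = derivWithin (F₁ e) (G.edge e) x :=
    derivWithin_congr (fun y hy => edgeDeriv_of_isSecondPrimitive h hy)
      (edgeDeriv_of_isSecondPrimitive h hx)
  have h2 : derivWithin (F₁ e) (G.edge e) x = F₂ e x :=
    (hd (by rwa [uIcc_eq_edge])).hasDerivWithinAt.derivWithin
      (uniqueDiffOn_Icc (G.length_pos e) x hx)
  rw [laplacian, h1, h2]

end OfSecondPrimitive

instance isFiniteMeasure_edgeMeasure (e : E) : IsFiniteMeasure (G.edgeMeasure e) := by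
  unfold edgeMeasure edge
  infer_instance

theorem isL2_of_continuousOn {f : E → ℝ → ℂ} (hf : ∀ e, ContinuousOn (f e) (G.edge e)) :
    G.IsL2 f := by
  intro e
  obtain ⟨c, hc⟩ := isCompact_Icc.exists_bound_of_continuousOn (hf e)
  refine MemLp.of_bound ((hf e).aestronglyMeasurable measurableSet_Icc) c ?_
  filter_upwards [ae_mem_edge e] with x hx using hc x hx

theorem IsAC2.isL2 {f : E → ℝ → ℂ} (hf : G.IsAC2 f) : G.IsL2 f :=
  isL2_of_continuousOn fun e => (hf e).2.1.continuousOn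

theorem IsL2.intervalIntegrable {f : E → ℝ → ℂ} (hf : G.IsL2 f) (e : E) :
    IntervalIntegrable (f e) volume 0 (G.length e) := by
  rw [intervalIntegrable_iff_integrableOn_Icc_of_le (G.length_pos e).le]
  exact (hf e).integrable one_le_two

/-- The class in `L² (G)` of a square integrable function. -/
noncomputable def IsL2.toL2 {f : E → ℝ → ℂ} (hf : G.IsL2 f) : G.L2 :=
  WithLp.toLp 2 fun e => (hf e).toLp (f e)

theorem IsL2.toL2_congr {f g : E → ℝ → ℂ} (hf : G.IsL2 f) (hg : G.IsL2 g)
    (h : ∀ e, f e =ᵐ[G.edgeMeasure e] g e) : hf.toL2 = hg.toL2 := by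
  ext1 e
  exact MemLp.toLp_congr (hf e) (hg e) (h e)

theorem IsL2.toL2_add {f g : E → ℝ → ℂ} (hf : G.IsL2 f) (hg : G.IsL2 g) (h : G.IsL2 (f + g)) :
    h.toL2 = hf.toL2 + hg.toL2 := by
  ext1 e
  exact MemLp.toLp_add (hf e) (hg e)

theorem IsL2.toL2_smul {f : E → ℝ → ℂ} (c : ℂ) (hf : G.IsL2 f) (h : G.IsL2 (c • f)) :
    h.toL2 = c • hf.toL2 := by
  ext1 e
  exact MemLp.toLp_const_smul c (hf e)

theorem exists_toL2_eq (u : G.L2) : ∃ (g : E → ℝ → ℂ) (hg : G.IsL2 g), hg.toL2 = u :=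
  ⟨fun e => u e, fun e => Lp.memLp (u e), by ext1 e; exact Lp.toLp_coeFn (u e) (Lp.memLp (u e))⟩

theorem IsL2.inner_toL2 [Fintype E] {f g : E → ℝ → ℂ} (hf : G.IsL2 f) (hg : G.IsL2 g) :
    inner ℂ hf.toL2 hg.toL2 = ∑ e, ∫ x, g e x * conj (f e x) ∂G.edgeMeasure e := by
  rw [PiLp.inner_apply]
  refine Finset.sum_congr rfl fun e _ => ?_
  rw [L2.inner_def]
  refine integral_congr_ae ?_
  filter_upwards [(hf e).coeFn_toLp, (hg e).coeFn_toLp] with x h1 h2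
  change inner ℂ ((hf e).toLp (f e) x) ((hg e).toLp (g e) x) = _
  rw [h1, h2, RCLike.inner_apply]

theorem IsL2.toL2_eq_toL2_iff {f g : E → ℝ → ℂ} (hf : G.IsL2 f) (hg : G.IsL2 g) :
    hf.toL2 = hg.toL2 ↔ ∀ e, f e =ᵐ[G.edgeMeasure e] g e := by
  refine ⟨fun h e => ?_, hf.toL2_congr hg⟩
  exact (MemLp.toLp_eq_toLp_iff (hf e) (hg e)).1 (congrArg (fun u : G.L2 => u e) h)

/-- The outward derivative at an endpoint. -/
noncomputable def outDeriv (G : MetricGraph V E) (f : E → ℝ → ℂ) (p : E × Bool) : ℂ :=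
  if p.2 then G.edgeDeriv f p.1 (G.length p.1) else - G.edgeDeriv f p.1 0

theorem outDeriv_of_isSecondPrimitive {F F₁ F₂ : E → ℝ → ℂ}
    (h : ∀ e, IsSecondPrimitive (G.length e) (F e) (F₁ e) (F₂ e)) (p : E × Bool) :
    G.outDeriv F p = if p.2 then F₁ p.1 (G.length p.1) else - F₁ p.1 0 := by
  rw [outDeriv, edgeDeriv_of_isSecondPrimitive h (right_mem _),
    edgeDeriv_of_isSecondPrimitive h (left_mem _)]

open Classical in
theorem normalDeriv_eq_sum [Fintype E] (f : E → ℝ → ℂ) (v : V) :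
    G.normalDeriv f v = ∑ p with G.vertex p = v, G.outDeriv f p := by
  rw [normalDeriv, Finset.sum_filter, Finset.sum_filter, Finset.sum_filter,
    Fintype.sum_prod_type, ← Finset.sum_sub_distrib]
  refine Finset.sum_congr rfl fun e _ => ?_
  rw [Fintype.sum_bool]
  split_ifs <;> simp [outDeriv, sub_eq_add_neg]

theorem IsContinuousAtVertices.apply_coord {f : E → ℝ → ℂ} (hf : G.IsContinuousAtVertices f)
    (p : E × Bool) : f p.1 (G.coord p) = G.vertexValue f (G.vertex p) :=
  hf _ _ (Function.surjInv_eq G.vertex_surjective (G.vertex p)).symm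

/-- Green's identity on the graph, with the boundary term as a sum over all endpoints. -/
theorem green_endpoints [Fintype E] {f u : E → ℝ → ℂ} (hf : G.IsAC2 f) (hu : G.IsAC2 u)
    (hf2 : G.IsL2 (G.laplacian f)) (hu2 : G.IsL2 (G.laplacian u)) :
    inner ℂ hu.isL2.toL2 hf2.toL2 - inner ℂ hu2.toL2 hf.isL2.toL2 =
      ∑ p : E × Bool, (f p.1 (G.coord p) * conj (G.outDeriv u p) -
        G.outDeriv f p * conj (u p.1 (G.coord p))) := by
  rw [IsL2.inner_toL2, IsL2.inner_toL2, ← Finset.sum_sub_distrib, Fintype.sum_prod_type]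
  refine Finset.sum_congr rfl fun e _ => ?_
  have hneg : ∀ {f : E → ℝ → ℂ}, G.IsL2 (G.laplacian f) →
      IntervalIntegrable (G.edgeDeriv (G.edgeDeriv f) e) volume 0 (G.length e) := by
    intro f hf
    convert (hf.intervalIntegrable e).neg using 1
    funext x
    simp [laplacian]
  have hi : ∀ {f g : E → ℝ → ℂ}, G.IsL2 f → G.IsL2 g →
      Integrable (fun x => g e x * conj (f e x)) (G.edgeMeasure e) := fun hf hg =>
    (hg e).integrable_mul (hf e).star
  have h := (hf.isSecondPrimitive e).green (hu.isSecondPrimitive e) (hneg hf2) (hneg hu2)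
  rw [← integral_sub (hi hu.isL2 hf2) (hi hu2 hf.isL2)]
  rw [intervalIntegral.integral_of_le (G.length_pos e).le, ← integral_Icc_eq_integral_Ioc] at h
  rw [Fintype.sum_bool]
  simp only [outDeriv, coord, if_true, Bool.false_eq_true, if_false, map_neg]
  have h' : ∫ x, (G.laplacian f e x * conj (u e x) - f e x * conj (G.laplacian u e x))
      ∂G.edgeMeasure e = - ∫ x in Icc 0 (G.length e), (G.edgeDeriv (G.edgeDeriv f) e x *
        conj (u e x) - f e x * conj (G.edgeDeriv (G.edgeDeriv u) e x)) := by
    rw [← integral_neg]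
    refine integral_congr_ae (ae_of_all _ fun x => ?_)
    simp only [laplacian, map_neg]
    ring
  rw [h', h]
  ring

/-- `f` and `f'` are absolutely continuous on the edges, `f''` is square integrable, `f` is
continuous at the vertices, and `∂_ν f - α f` takes the values `h` at the vertices. -/
structure HasDefect [Fintype E] (G : MetricGraph V E) (α : V → ℝ) (h : V → ℂ)
    (f : E → ℝ → ℂ) : Prop where
  isAC2 : G.IsAC2 f
  isL2_laplacian : G.IsL2 (G.laplacian f)
  cont : G.IsContinuousAtVertices f
  defect : ∀ v, G.normalDeriv f v - α v * G.vertexValue f v = h v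

theorem mem_domainFun_iff [Fintype E] {α : V → ℝ} {f : E → ℝ → ℂ} :
    f ∈ G.domainFun α ↔ G.HasDefect α 0 f :=
  ⟨fun h => ⟨h.2.1, h.2.2.1, h.2.2.2.1, h.2.2.2.2⟩, fun h => ⟨h.1.isL2, h.1, h.2, h.3, h.4⟩⟩

theorem HasDefect.add [Fintype E] {α : V → ℝ} {h k : V → ℂ} {f g : E → ℝ → ℂ}
    (hf : G.HasDefect α h f) (hg : G.HasDefect α k g) : G.HasDefect α (h + k) (f + g) where
  isAC2 := hf.isAC2.add hg.isAC2
  isL2_laplacian := IsL2.laplacian_add hf.isAC2 hg.isAC2 hf.isL2_laplacian hg.isL2_laplacian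
  cont p q hpq := by simp only [Pi.add_apply, hf.cont p q hpq, hg.cont p q hpq]
  defect v := by
    rw [hf.isAC2.normalDeriv_add hg.isAC2]
    have h3 : G.vertexValue (f + g) v = G.vertexValue f v + G.vertexValue g v := rfl
    rw [h3, Pi.add_apply, ← hf.defect, ← hg.defect]
    ring

theorem HasDefect.smul [Fintype E] {α : V → ℝ} {h : V → ℂ} {f : E → ℝ → ℂ}
    (hf : G.HasDefect α h f) (c : ℂ) : G.HasDefect α (c • h) (c • f) where
  isAC2 := hf.isAC2.smul c
  isL2_laplacian := by
    rw [laplacian_smul]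
    exact fun e => (hf.isL2_laplacian e).const_smul c
  cont p q hpq := by simp only [Pi.smul_apply, hf.cont p q hpq]
  defect v := by
    have h3 : G.vertexValue (c • f) v = c * G.vertexValue f v := rfl
    rw [normalDeriv_smul, h3, Pi.smul_apply, smul_eq_mul, ← hf.defect]
    ring

/-- Green's identity for functions satisfying inhomogeneous vertex conditions. -/
theorem HasDefect.green [Fintype V] [Fintype E] {α : V → ℝ} {h k : V → ℂ} {f u : E → ℝ → ℂ}
    (hf : G.HasDefect α h f) (hu : G.HasDefect α k u) :
    inner ℂ hu.isAC2.isL2.toL2 hf.isL2_laplacian.toL2 -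
        inner ℂ hu.isL2_laplacian.toL2 hf.isAC2.isL2.toL2 =
      ∑ v, (G.vertexValue f v * conj (k v) - h v * conj (G.vertexValue u v)) := by
  classical
  rw [green_endpoints hf.isAC2 hu.isAC2, ← Finset.sum_fiberwise (g := G.vertex)]
  refine Finset.sum_congr rfl fun v _ => ?_
  have hval : ∀ {f : E → ℝ → ℂ}, G.IsContinuousAtVertices f →
      ∀ p ∈ Finset.univ.filter (fun p => G.vertex p = v),
        f p.1 (G.coord p) = G.vertexValue f v := by
    intro f hf p hp
    rw [hf.apply_coord, (Finset.mem_filter.1 hp).2]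
  rw [Finset.sum_congr rfl fun p hp => by rw [hval hf.cont p hp, hval hu.cont p hp],
    Finset.sum_sub_distrib, ← Finset.mul_sum, ← Finset.sum_mul, ← map_sum, ← normalDeriv_eq_sum,
    ← normalDeriv_eq_sum, ← hf.defect, ← hu.defect]
  simp only [map_sub, map_mul, Complex.conj_ofReal]
  ring

end MetricGraph

/-! ### Symmetry of the operator and its eigenspaces -/

namespace MetricGraph

variable {V E : Type*} {G : MetricGraph V E}

/-- `A u = z` in `L² (G)` means that `u` and `z` are the classes of `f` and `-f''` for some `f`
satisfying the vertex conditions. -/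
theorem mem_deltaLaplacian_graph [Fintype E] {α : V → ℝ} {u z : G.L2} :
    (∃ h : u ∈ (G.deltaLaplacian α).domain, G.deltaLaplacian α ⟨u, h⟩ = z) ↔
      ∃ (f : E → ℝ → ℂ) (hf : G.HasDefect α 0 f),
        hf.isAC2.isL2.toL2 = u ∧ hf.isL2_laplacian.toL2 = z := by
  have h1 : (u, z) ∈ (G.deltaLaplacian α).graph ↔
      ∃ h : u ∈ (G.deltaLaplacian α).domain, G.deltaLaplacian α ⟨u, h⟩ = z := by
    rw [LinearPMap.mem_graph_iff]
    constructor
    · rintro ⟨y, rfl, rfl⟩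
      exact ⟨y.2, rfl⟩
    · rintro ⟨h, rfl⟩
      exact ⟨⟨u, h⟩, rfl, rfl⟩
  rw [← h1, deltaLaplacian_graph]
  constructor
  · rintro ⟨f, hf⟩
    exact ⟨f.1, mem_domainFun_iff.1 f.2, congrArg Prod.fst hf, congrArg Prod.snd hf⟩
  · rintro ⟨f, hf, rfl, rfl⟩
    exact ⟨⟨f, mem_domainFun_iff.2 hf⟩, rfl⟩

theorem deltaLaplacian_symmetric [Fintype V] [Fintype E] (α : V → ℝ)
    (x y : (G.deltaLaplacian α).domain) :
    inner ℂ (G.deltaLaplacian α x) (y : G.L2) = inner ℂ (x : G.L2) (G.deltaLaplacian α y) := by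
  obtain ⟨f, hf, h1, h2⟩ := mem_deltaLaplacian_graph.1 ⟨x.2, rfl⟩
  obtain ⟨g, hg, h3, h4⟩ := mem_deltaLaplacian_graph.1 ⟨y.2, rfl⟩
  have := hg.green hf
  rw [h1, h2, h3, h4] at this
  simp only [Pi.zero_apply, map_zero, mul_zero, zero_mul, sub_zero, Finset.sum_const_zero] at this
  exact (sub_eq_zero.1 this).symm

theorem mem_eigenspace_deltaLaplacian [Fintype E] {α : V → ℝ} {z : ℂ} {u : G.L2} :
    u ∈ UnboundedOperator.eigenspace (G.deltaLaplacian α) z ↔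
      ∃ (f : E → ℝ → ℂ) (hf : G.HasDefect α 0 f), hf.isAC2.isL2.toL2 = u ∧
        ∀ e, ∀ᵐ x ∂G.edgeMeasure e, G.laplacian f e x = z * f e x := by
  rw [UnboundedOperator.mem_eigenspace, mem_deltaLaplacian_graph]
  refine exists_congr fun f => exists_congr fun hf => and_congr_right ?_
  rintro rfl
  have hs : G.IsL2 (z • f) := fun e => (hf.isAC2.isL2 e).const_smul z
  rw [← IsL2.toL2_smul z _ hs]
  exact IsL2.toL2_eq_toL2_iff _ _

/-- The function equal to `a e * C + b e * S` on the edge `e`. -/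
noncomputable def edgewise (C S : ℝ → ℝ) (a b : E → ℂ) : E → ℝ → ℂ :=
  fun e x => a e * C x + b e * S x

/-- The derivative of `edgewise C S a b`. -/
noncomputable def edgewiseDeriv (lam : ℝ) (C S : ℝ → ℝ) (a b : E → ℂ) : E → ℝ → ℂ :=
  fun e x => -lam * a e * S x + b e * C x

section Homogeneous

variable {lam : ℝ} {C S : ℝ → ℝ}

theorem isSecondPrimitive_edgewise (G : MetricGraph V E) (h : IsFundamentalSystem lam C S)
    (a b : E → ℂ) (e : E) :
    IsSecondPrimitive (G.length e) (edgewise C S a b e) (edgewiseDeriv lam C S a b e)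
      (fun x => -lam * edgewise C S a b e x) :=
  h.isSecondPrimitive _ _ _

theorem isAC2_edgewise (G : MetricGraph V E) (h : IsFundamentalSystem lam C S)
    (a b : E → ℂ) : G.IsAC2 (edgewise C S a b) :=
  isAC2_of_isSecondPrimitive (isSecondPrimitive_edgewise G h a b)

theorem laplacian_edgewise (G : MetricGraph V E) (h : IsFundamentalSystem lam C S)
    (a b : E → ℂ) (e : E) :
    ∀ᵐ x ∂G.edgeMeasure e, G.laplacian (edgewise C S a b) e x = lam * edgewise C S a b e x := by
  filter_upwards [laplacian_of_isSecondPrimitive (isSecondPrimitive_edgewise G h a b) e] with x hx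
  rw [hx]
  ring

/-- The solutions of `-f'' = lam f` on the edges are the combinations of `C` and `S`. -/
theorem IsAC2.eq_edgewise (h : IsFundamentalSystem lam C S) {f : E → ℝ → ℂ} (hf : G.IsAC2 f)
    (hode : ∀ e, ∀ᵐ x ∂G.edgeMeasure e, G.laplacian f e x = lam * f e x) {e : E} {x : ℝ}
    (hx : x ∈ G.edge e) :
    f e x = edgewise C S (fun e => f e 0) (fun e => G.edgeDeriv f e 0) e x ∧
    G.edgeDeriv f e x =
      edgewiseDeriv lam C S (fun e => f e 0) (fun e => G.edgeDeriv f e 0) e x := by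
  refine h.eq_of_ae_eq (hf.isSecondPrimitive e) ?_ (by rwa [uIcc_eq_edge])
  have := (ae_restrict_iff' measurableSet_Icc).1 (hode e)
  filter_upwards [this] with y hy hy'
  rw [uIcc_eq_edge] at hy'
  have := hy hy'
  rw [laplacian] at this
  linear_combination -this

/-- An eigenfunction is determined by its initial values at the left endpoints of the edges. -/
theorem finiteDimensional_eigenspace [Fintype E] (α : V → ℝ) (lam : ℝ) :
    FiniteDimensional ℂ (UnboundedOperator.eigenspace (G.deltaLaplacian α) (lam : ℂ)) := by
  obtain ⟨C, S, h⟩ := exists_isFundamentalSystem lam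
  let Φ : (E → ℂ) × (E → ℂ) →ₗ[ℂ] G.L2 :=
    { toFun := fun p => (isAC2_edgewise G h p.1 p.2).isL2.toL2
      map_add' := fun p q => by
        have hpq : edgewise C S (p + q).1 (p + q).2 =
            edgewise C S p.1 p.2 + edgewise C S q.1 q.2 := by
          funext e x
          simp only [edgewise, Prod.fst_add, Prod.snd_add, Pi.add_apply]
          ring
        rw [← IsL2.toL2_add _ _ ((isAC2_edgewise G h p.1 p.2).add
          (isAC2_edgewise G h q.1 q.2)).isL2]
        exact IsL2.toL2_congr _ _ fun e => by rw [hpq]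
      map_smul' := fun c p => by
        have hcp : edgewise C S (c • p).1 (c • p).2 = c • edgewise C S p.1 p.2 := by
          funext e x
          simp only [edgewise, Prod.smul_fst, Prod.smul_snd, Pi.smul_apply, smul_eq_mul]
          ring
        rw [RingHom.id_apply, ← IsL2.toL2_smul c _ ((isAC2_edgewise G h p.1 p.2).smul c).isL2]
        exact IsL2.toL2_congr _ _ fun e => by rw [hcp] }
  refine Submodule.finiteDimensional_of_le (S₂ := LinearMap.range Φ) fun u hu => ?_
  obtain ⟨f, hf, rfl, hode⟩ := mem_eigenspace_deltaLaplacian.1 hu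
  refine ⟨(fun e => f e 0, fun e => G.edgeDeriv f e 0), IsL2.toL2_congr _ _ fun e => ?_⟩
  filter_upwards [ae_mem_edge e] with x hx
  exact (hf.isAC2.eq_edgewise h hode hx).1.symm

end Homogeneous

/-! ### Test functions -/

/-- For each vertex `l` there is a function that vanishes at all vertices and satisfies
`∂_ν w - α w = 1` at `l`, `= 0` at the other vertices. -/
theorem exists_hasDefect_single [Fintype E] [DecidableEq V] (α : V → ℝ) (l : V) :
    ∃ w : E → ℝ → ℂ, G.HasDefect α (fun v => if v = l then 1 else 0) w ∧
      ∀ v, G.vertexValue w v = 0 := by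
  classical
  obtain ⟨p₀, rfl⟩ := G.vertex_surjective l
  -- On each edge take a cubic polynomial that vanishes at both endpoints and has outward
  -- derivative `1` at the endpoint `p₀` and `0` at all others.
  obtain ⟨β, hβ⟩ : ∃ β : E × Bool → ℂ, ∀ p, β p = if p = p₀ then 1 else 0 := ⟨_, fun _ => rfl⟩
  obtain ⟨L, hL⟩ : ∃ L : E → ℂ, ∀ e, L e = G.length e := ⟨_, fun _ => rfl⟩
  have hL0 : ∀ e, L e ≠ 0 := fun e => by rw [hL]; exact_mod_cast (G.length_pos e).ne'
  obtain ⟨a, ha⟩ : ∃ a : E → ℂ, ∀ e, L e * a e = -β (e, false) :=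
    ⟨fun e => -β (e, false) / L e, fun e => by field_simp [hL0 e]⟩
  obtain ⟨b, hb⟩ : ∃ b : E → ℂ, ∀ e, -L e * (a e + b e * L e) = β (e, true) :=
    ⟨fun e => (-β (e, true) / L e - a e) / L e, fun e => by field_simp [hL0 e]; ring⟩
  have hd : ∀ x : ℝ, HasDerivAt (fun x : ℝ => (x : ℂ)) 1 x := fun x =>
    (hasDerivAt_id x).ofReal_comp
  have hsp : ∀ e, IsSecondPrimitive (G.length e)
      (fun x => (x : ℂ) * (L e - x) * (a e + b e * x))
      (fun x => (L e - 2 * x) * (a e + b e * x) + x * (L e - x) * b e)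
      (fun x => -2 * (a e + b e * x) + 2 * (L e - 2 * x) * b e) := by
    intro e
    refine .of_hasDerivAt (fun x => ?_) (fun x => ?_) (by fun_prop)
    · refine (((hd x).mul ((hd x).const_sub (L e))).mul
        (((hd x).const_mul (b e)).const_add (a e))).congr_deriv ?_
      simp only [Pi.mul_apply]
      ring
    · refine (((((hd x).const_mul 2).const_sub (L e)).mul
        (((hd x).const_mul (b e)).const_add (a e))).add
        (((hd x).mul ((hd x).const_sub (L e))).mul_const (b e))).congr_deriv ?_
      ring
  have hval : ∀ p : E × Bool, (fun e (x : ℝ) => (x : ℂ) * (L e - x) * (a e + b e * x)) p.1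
      (G.coord p) = 0 := by
    rintro ⟨e, _ | _⟩ <;> simp [coord, hL]
  refine ⟨fun e x => (x : ℂ) * (L e - x) * (a e + b e * x),
    ⟨isAC2_of_isSecondPrimitive hsp, fun e => ?_, fun p q _ => (hval p).trans (hval q).symm,
    fun v => ?_⟩, fun v => hval _⟩
  · refine MemLp.ae_eq (laplacian_of_isSecondPrimitive hsp e).symm ?_
    refine isL2_of_continuousOn (G := G)
      (f := fun e x => -(-2 * (a e + b e * x) + 2 * (L e - 2 * x) * b e)) (fun e => ?_) e
    fun_prop
  · have hout : ∀ p, G.outDeriv (fun e x => (x : ℂ) * (L e - x) * (a e + b e * x)) p = β p := by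
      rintro ⟨e, _ | _⟩
      · rw [outDeriv_of_isSecondPrimitive hsp]
        simpa using (congrArg Neg.neg (ha e))
      · rw [outDeriv_of_isSecondPrimitive hsp, ← hb, hL]
        simp only [if_true]
        ring
    have hv : G.vertexValue (fun e x => (x : ℂ) * (L e - x) * (a e + b e * x)) v = 0 := hval _
    rw [normalDeriv_eq_sum, hv, mul_zero, sub_zero, Finset.sum_congr rfl fun p _ => hout p]
    simp only [hβ, Finset.sum_ite_eq', Finset.mem_filter, Finset.mem_univ, true_and]
    simp only [eq_comm]

/-! ### Solvability -/

section Solvability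

variable {lam : ℝ} {C S : ℝ → ℝ}

theorem edgewise_coord (h : IsFundamentalSystem lam C S) (a b : E → ℂ) (e : E) :
    edgewise C S a b e (G.coord (e, false)) = a e ∧
    edgewise C S a b e (G.coord (e, true)) = a e * C (G.length e) + b e * S (G.length e) := by
  simp [coord, edgewise, h.C_zero, h.S_zero]

theorem outDeriv_edgewise (h : IsFundamentalSystem lam C S) (a b : E → ℂ) (e : E) :
    G.outDeriv (edgewise C S a b) (e, false) = - b e ∧
    G.outDeriv (edgewise C S a b) (e, true) =
      -lam * a e * S (G.length e) + b e * C (G.length e) := by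
  simp [outDeriv_of_isSecondPrimitive (isSecondPrimitive_edgewise G h a b), edgewiseDeriv,
    h.C_zero, h.S_zero]

open Classical in
/-- The pairs (values, outward derivatives) at the endpoints that satisfy the vertex
conditions. -/
noncomputable def vertexConditions [Fintype E] (G : MetricGraph V E) (α : V → ℝ) :
    Submodule ℂ ((E × Bool → ℂ) × (E × Bool → ℂ)) where
  carrier := {t | (∀ p q, G.vertex p = G.vertex q → t.1 p = t.1 q) ∧
    ∀ p, ∑ q with G.vertex q = G.vertex p, t.2 q = α (G.vertex p) * t.1 p}
  add_mem' := by
    rintro s t ⟨hs, hs'⟩ ⟨ht, ht'⟩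
    refine ⟨fun p q hpq => ?_, fun p => ?_⟩
    · simp [hs p q hpq, ht p q hpq]
    · simp [Finset.sum_add_distrib, hs', ht', mul_add]
  zero_mem' := ⟨fun _ _ _ => rfl, fun _ => by simp⟩
  smul_mem' := by
    rintro c t ⟨ht, ht'⟩
    refine ⟨fun p q hpq => ?_, fun p => ?_⟩
    · simp [ht p q hpq]
    · simp [← Finset.mul_sum, ht']
      ring

/-- The pairs (values, outward derivatives) at the endpoints of the solutions of `-f'' = lam f` on
the edges, as the range of a linear map on the initial values. -/
noncomputable def edgewiseTrace (G : MetricGraph V E) (lam : ℝ) (C S : ℝ → ℝ) :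
    (E → ℂ) × (E → ℂ) →ₗ[ℂ] (E × Bool → ℂ) × (E × Bool → ℂ) where
  toFun t := (fun p => if p.2 then t.1 p.1 * C (G.length p.1) + t.2 p.1 * S (G.length p.1)
      else t.1 p.1,
    fun p => if p.2 then -lam * t.1 p.1 * S (G.length p.1) + t.2 p.1 * C (G.length p.1)
      else - t.2 p.1)
  map_add' s t := by
    ext p <;> simp only [Prod.fst_add, Prod.snd_add, Pi.add_apply] <;> split_ifs <;> ring
  map_smul' c t := by
    ext p <;> simp only [Prod.smul_fst, Prod.smul_snd, Pi.smul_apply, smul_eq_mul,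
      RingHom.id_apply] <;> split_ifs <;> ring

theorem edgewiseTrace_apply (h : IsFundamentalSystem lam C S) (a b : E → ℂ) :
    edgewiseTrace G lam C S (a, b) = (fun p => edgewise C S a b p.1 (G.coord p),
      fun p => G.outDeriv (edgewise C S a b) p) := by
  ext ⟨e, _ | _⟩ <;>
  simp [edgewiseTrace, edgewise_coord h, outDeriv_edgewise h]

/-- The sesquilinear form given by the boundary terms of Green's identity. -/
noncomputable def boundaryForm [Fintype E] (t s : (E × Bool → ℂ) × (E × Bool → ℂ)) : ℂ :=
  ∑ p, (t.1 p * conj (s.2 p) - t.2 p * conj (s.1 p))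

/-- The vertex conditions are a space containing its orthogonal complement with respect to the
boundary form. -/
theorem mem_vertexConditions_of_boundaryForm_eq_zero [Fintype E] {α : V → ℝ}
    {s : (E × Bool → ℂ) × (E × Bool → ℂ)}
    (hs : ∀ t ∈ G.vertexConditions α, boundaryForm t s = 0) : s ∈ G.vertexConditions α := by
  classical
  constructor
  · intro p q hpq
    have := hs (0, fun r => (if r = p then 1 else 0) - if r = q then 1 else 0) (by
      refine ⟨fun _ _ _ => rfl, fun r => ?_⟩
      simp [Finset.sum_sub_distrib, Finset.sum_ite_eq', hpq])
    simp only [boundaryForm, Pi.zero_apply, zero_mul, zero_sub, sub_mul, ite_mul, one_mul,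
      Finset.sum_neg_distrib, Finset.sum_sub_distrib, Finset.sum_ite_eq', Finset.mem_univ,
      if_true, neg_eq_zero, sub_eq_zero] at this
    exact (starRingEnd ℂ).injective this
  · intro p
    have := hs (fun r => if G.vertex r = G.vertex p then 1 else 0,
        fun r => if r = p then α (G.vertex p) else 0) (by
      refine ⟨fun r q hrq => by simp only [hrq], fun r => ?_⟩
      simp only [Finset.sum_ite_eq', Finset.mem_filter, Finset.mem_univ, true_and]
      by_cases hr : G.vertex r = G.vertex p
      · simp [hr]
      · simp [hr, Ne.symm hr])
    simp only [boundaryForm, ite_mul, one_mul, zero_mul, Finset.sum_sub_distrib,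
      Finset.sum_ite_eq', Finset.mem_univ, if_true, sub_eq_zero] at this
    apply (starRingEnd ℂ).injective
    rw [map_sum, Finset.sum_filter, map_mul, Complex.conj_ofReal]
    convert this

/-- The traces of the solutions of `-f'' = lam f` are a space containing its orthogonal complement
with respect to the boundary form. -/
theorem mem_range_edgewiseTrace_of_boundaryForm_eq_zero [Fintype E]
    (h : IsFundamentalSystem lam C S) {s : (E × Bool → ℂ) × (E × Bool → ℂ)}
    (hs : ∀ a b, boundaryForm (edgewiseTrace G lam C S (a, b)) s = 0) :
    s ∈ LinearMap.range (edgewiseTrace G lam C S) := by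
  classical
  refine ⟨(fun e => s.1 (e, false), fun e => - s.2 (e, false)), ?_⟩
  -- Test with the solutions `C` and `S` on a single edge.
  have key : ∀ e, s.1 (e, false) = -(S (G.length e) : ℂ) * s.2 (e, true) +
        C (G.length e) * s.1 (e, true) ∧
      s.2 (e, false) = -(C (G.length e) : ℂ) * s.2 (e, true) -
        lam * S (G.length e) * s.1 (e, true) := by
    intro e
    have h1 := hs (fun e' => if e' = e then 1 else 0) 0
    have h2 := hs 0 (fun e' => if e' = e then 1 else 0)
    simp only [boundaryForm, edgewiseTrace, LinearMap.coe_mk, AddHom.coe_mk,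
      Fintype.sum_prod_type, Fintype.sum_bool, Pi.zero_apply, if_true, Bool.false_eq_true,
      if_false, zero_mul, mul_zero, add_zero, zero_add, neg_zero, sub_zero, zero_sub] at h1 h2
    rw [Finset.sum_eq_single e (fun e' _ he' => by simp [he']) (by simp)] at h1 h2
    simp only [if_true] at h1 h2
    constructor
    · apply (starRingEnd ℂ).injective
      simp only [map_add, map_mul, map_neg, Complex.conj_ofReal]
      linear_combination h2
    · apply (starRingEnd ℂ).injective
      simp only [map_sub, map_mul, map_neg, Complex.conj_ofReal]
      linear_combination h1
  have hw := fun e => h.wronskian_ofReal (G.length e)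
  ext ⟨e, _ | _⟩
  · simp [edgewiseTrace]
  · simp only [edgewiseTrace, LinearMap.coe_mk, AddHom.coe_mk, if_true, key e]
    linear_combination s.1 (e, true) * hw e
  · simp [edgewiseTrace]
  · simp only [edgewiseTrace, LinearMap.coe_mk, AddHom.coe_mk, if_true, key e]
    linear_combination s.2 (e, true) * hw e

/-- The boundary form is nondegenerate: it represents every linear functional on the boundary
data. -/
theorem exists_boundaryForm_eq [Fintype E]
    (φ : (E × Bool → ℂ) × (E × Bool → ℂ) →ₗ[ℂ] ℂ) : ∃ s, ∀ t, φ t = boundaryForm t s := by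
  classical
  refine ⟨(fun p => - conj (φ (0, fun q => if p = q then 1 else 0)),
      fun p => conj (φ ((fun q => if p = q then 1 else 0), 0))),
    fun t => ?_⟩
  have h1 : φ (t.1, 0) = ∑ p, t.1 p * φ ((fun q => if p = q then 1 else 0), 0) := by
    simpa using (φ ∘ₗ LinearMap.inl ℂ _ _).pi_apply_eq_sum_univ t.1
  have h2 : φ (0, t.2) = ∑ p, t.2 p * φ (0, fun q => if p = q then 1 else 0) := by
    simpa using (φ ∘ₗ LinearMap.inr ℂ _ _).pi_apply_eq_sum_univ t.2
  have h3 : t = (t.1, 0) + (0, t.2) := by simp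
  rw [h3, map_add, h1, h2, ← Finset.sum_add_distrib, boundaryForm]
  refine Finset.sum_congr rfl fun p _ => ?_
  simp

theorem mem_vertexConditions_iff [Fintype E] {α : V → ℝ} {f : E → ℝ → ℂ} (hf : G.IsAC2 f)
    (hf2 : G.IsL2 (G.laplacian f)) :
    (fun p : E × Bool => f p.1 (G.coord p), fun p => G.outDeriv f p) ∈ G.vertexConditions α ↔
      G.HasDefect α 0 f := by
  constructor
  · rintro ⟨h1, h2⟩
    refine ⟨hf, hf2, h1, fun v => ?_⟩
    obtain ⟨p, rfl⟩ := G.vertex_surjective v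
    have := h2 p
    have hc : G.IsContinuousAtVertices f := h1
    simp only [hc.apply_coord] at this
    rw [normalDeriv_eq_sum, this, sub_self, Pi.zero_apply]
  · intro h
    refine ⟨h.cont, fun p => ?_⟩
    have := h.defect (G.vertex p)
    rw [normalDeriv_eq_sum, Pi.zero_apply, sub_eq_zero] at this
    simp only [h.cont.apply_coord]
    exact this

/-- The equation `A u - lam u = z` is solvable if `z` is orthogonal to `ker (A - lam)`. -/
theorem exists_deltaLaplacian_sub_smul_eq [Fintype E] (α : V → ℝ) (lam : ℝ) {z : G.L2}
    (hz : ∀ u ∈ UnboundedOperator.eigenspace (G.deltaLaplacian α) (lam : ℂ), inner ℂ u z = 0) :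
    ∃ u : (G.deltaLaplacian α).domain, G.deltaLaplacian α u - (lam : ℂ) • (u : G.L2) = z := by
  obtain ⟨C, S, h⟩ := exists_isFundamentalSystem lam
  obtain ⟨g, hg, rfl⟩ := exists_toL2_eq z
  choose F F₁ hF using fun e => h.exists_particular (hg.intervalIntegrable e)
  have hFac : G.IsAC2 F := isAC2_of_isSecondPrimitive hF
  have hFlap : ∀ e, ∀ᵐ x ∂G.edgeMeasure e,
      G.laplacian F e x = ((lam : ℂ) • F + g) e x := by
    intro e
    filter_upwards [laplacian_of_isSecondPrimitive hF e] with x hx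
    rw [hx]
    simp only [Pi.add_apply, Pi.smul_apply, smul_eq_mul]
    ring
  have hlF : G.IsL2 ((lam : ℂ) • F) := fun e => (hFac.isL2 e).const_smul (lam : ℂ)
  have hFg : G.IsL2 ((lam : ℂ) • F + g) := fun e => (hlF e).add (hg e)
  have hF2 : G.IsL2 (G.laplacian F) := fun e =>
    (hFg e).ae_eq (EventuallyEq.symm (hFlap e))
  -- It suffices to correct the boundary values of `F` by a solution of the homogeneous equation.
  suffices hmem : (fun p : E × Bool => F p.1 (G.coord p), fun p => G.outDeriv F p) ∈
      G.vertexConditions α ⊔ LinearMap.range (edgewiseTrace G lam C S) by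
    obtain ⟨t, ht, _, ⟨⟨a, b⟩, rfl⟩, hts⟩ := Submodule.mem_sup.1 hmem
    have hac := isAC2_edgewise G h (-a) (-b)
    have hlap := laplacian_edgewise G h (-a) (-b)
    have hl2 : G.IsL2 ((lam : ℂ) • edgewise C S (-a) (-b)) := fun e =>
      (hac.isL2 e).const_smul (lam : ℂ)
    have hlap2 : G.IsL2 (G.laplacian (edgewise C S (-a) (-b))) := fun e =>
      (hl2 e).ae_eq (EventuallyEq.symm (hlap e))
    have hsum : G.HasDefect α 0 (F + edgewise C S (-a) (-b)) := by
      rw [← mem_vertexConditions_iff (hFac.add hac) (IsL2.laplacian_add hFac hac hF2 hlap2)]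
      convert ht using 1
      rw [← eq_sub_iff_add_eq] at hts
      rw [hts, sub_eq_add_neg, ← map_neg, Prod.neg_mk, edgewiseTrace_apply h]
      ext p
      · rfl
      · simp only [outDeriv, Prod.mk_add_mk, Pi.add_apply,
          hFac.edgeDeriv_add hac _ _ (right_mem _), hFac.edgeDeriv_add hac _ _ (left_mem _)]
        split_ifs <;> ring
    obtain ⟨hu, hu'⟩ := mem_deltaLaplacian_graph.2 ⟨_, hsum, rfl, rfl⟩
    refine ⟨⟨_, hu⟩, ?_⟩
    have hs : G.IsL2 ((lam : ℂ) • (F + edgewise C S (-a) (-b))) := fun e =>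
      (hsum.isAC2.isL2 e).const_smul (lam : ℂ)
    have hsg : G.IsL2 ((lam : ℂ) • (F + edgewise C S (-a) (-b)) + g) := fun e =>
      (hs e).add (hg e)
    rw [hu', sub_eq_iff_eq_add', ← IsL2.toL2_smul _ _ hs, ← IsL2.toL2_add _ _ hsg]
    refine IsL2.toL2_congr _ _ fun e => ?_
    filter_upwards [hFac.laplacian_add hac e, hFlap e, hlap e] with x h1 h2 h3
    rw [h1, Pi.add_apply, h2, h3]
    simp only [Pi.add_apply, Pi.smul_apply, smul_eq_mul]
    ring
  -- Otherwise a functional separates the boundary values of `F`; it comes from an eigenfunction.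
  by_contra hmem
  obtain ⟨φ, hφ, hker⟩ := Submodule.exists_le_ker_of_notMem hmem
  obtain ⟨s, hs⟩ := exists_boundaryForm_eq φ
  have hs1 : s ∈ G.vertexConditions α := mem_vertexConditions_of_boundaryForm_eq_zero
    fun t ht => by rw [← hs]; exact hker (Submodule.mem_sup_left ht)
  have hs2 : s ∈ LinearMap.range (edgewiseTrace G lam C S) :=
    mem_range_edgewiseTrace_of_boundaryForm_eq_zero h
    fun a b => by rw [← hs]; exact hker (Submodule.mem_sup_right ⟨_, rfl⟩)
  obtain ⟨⟨a, b⟩, rfl⟩ := hs2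
  have hac := isAC2_edgewise G h a b
  have hlap := laplacian_edgewise G h a b
  have hl2 : G.IsL2 ((lam : ℂ) • edgewise C S a b) := fun e => (hac.isL2 e).const_smul (lam : ℂ)
  have hlap2 : G.IsL2 (G.laplacian (edgewise C S a b)) := fun e =>
    (hl2 e).ae_eq (EventuallyEq.symm (hlap e))
  have hdef : G.HasDefect α 0 (edgewise C S a b) := by
    rw [← mem_vertexConditions_iff hac hlap2, ← edgewiseTrace_apply h]
    exact hs1
  have horth := hz _ (mem_eigenspace_deltaLaplacian.2 ⟨_, hdef, rfl, hlap⟩)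
  have hgreen := green_endpoints hFac hac hF2 hlap2
  have e1 : hF2.toL2 = (lam : ℂ) • hFac.isL2.toL2 + hg.toL2 := by
    rw [← IsL2.toL2_smul _ _ hlF, ← IsL2.toL2_add _ _ hFg]
    exact IsL2.toL2_congr _ _ hFlap
  have e2 : hlap2.toL2 = (lam : ℂ) • hac.isL2.toL2 := by
    rw [← IsL2.toL2_smul _ _ hl2]
    exact IsL2.toL2_congr _ _ hlap
  rw [e1, e2, inner_add_right, inner_smul_right, inner_smul_left, Complex.conj_ofReal, horth,
    add_zero, sub_self] at hgreen
  refine hφ ?_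
  rw [hs, edgewiseTrace_apply h]
  exact hgreen.symm

end Solvability

end MetricGraph

/-! ### The resolvent of a symmetric operator near an isolated eigenvalue -/

namespace UnboundedOperator

variable {H : Type*} [NormedAddCommGroup H] [InnerProductSpace ℂ H]

/-- `T` is the resolvent `(A - z)⁻¹`. -/
def IsResolventAt (A : H →ₗ.[ℂ] H) (z : ℂ) (T : H →L[ℂ] H) : Prop :=
  (∀ u, ∃ h : T u ∈ A.domain, A ⟨T u, h⟩ - z • T u = u) ∧
    ∀ u : A.domain, T (A u - z • (u : H)) = u

theorem eigenspace_le_domain (A : H →ₗ.[ℂ] H) (z : ℂ) : eigenspace A z ≤ A.domain := by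
  rintro u hu
  exact ((mem_eigenspace A z u).1 hu).1

/-- The reduced resolvent: if `A` is symmetric and `A u - lam u = z` is solvable for all `z`
orthogonal to the eigenspace, then `A - lam` has a bounded inverse on the orthogonal complement of
the eigenspace. Boundedness is the Hellinger–Toeplitz theorem. -/
theorem exists_reducedResolvent [CompleteSpace H] {A : H →ₗ.[ℂ] H} {lam : ℝ}
    [FiniteDimensional ℂ (eigenspace A (lam : ℂ))]
    (hsym : ∀ x y : A.domain, inner ℂ (A x) (y : H) = inner ℂ (x : H) (A y))
    (hrange : ∀ z, (∀ u ∈ eigenspace A (lam : ℂ), inner ℂ u z = 0) →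
      ∃ u : A.domain, A u - (lam : ℂ) • (u : H) = z) :
    ∃ S : H →L[ℂ] H,
      (∀ u, ∃ h : S u ∈ A.domain,
        A ⟨S u, h⟩ - (lam : ℂ) • S u = u - (eigenspace A (lam : ℂ)).starProjection u) ∧
      (∀ u : A.domain, S (A u - (lam : ℂ) • (u : H)) =
        u - (eigenspace A (lam : ℂ)).starProjection (u : H)) ∧
      (∀ u, S ((eigenspace A (lam : ℂ)).starProjection u) = 0) ∧
      ∀ u, (eigenspace A (lam : ℂ)).starProjection (S u) = 0 := by
  set K := eigenspace A (lam : ℂ) with hK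
  set P := K.starProjection with hP
  let D : A.domain →ₗ[ℂ] H := A.toFun - (lam : ℂ) • A.domain.subtype
  have hD : ∀ u : A.domain, D u = A u - (lam : ℂ) • (u : H) := fun u => rfl
  have hDsym : ∀ x y : A.domain, inner ℂ (D x) (y : H) = inner ℂ (x : H) (D y) := by
    intro x y
    rw [hD, hD, inner_sub_left, inner_sub_right, hsym, inner_smul_left, inner_smul_right,
      Complex.conj_ofReal]
  have hDK : ∀ u : A.domain, (u : H) ∈ K ↔ D u = 0 := by
    intro u
    rw [hK, mem_eigenspace, hD, sub_eq_zero]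
    exact ⟨fun ⟨_, h⟩ => h, fun h => ⟨u.2, h⟩⟩
  have hPD : ∀ u : A.domain, P (D u) = 0 := by
    intro u
    rw [hP, Submodule.starProjection_apply_eq_zero_iff, Submodule.mem_orthogonal]
    intro k hk
    have := hDsym ⟨k, eigenspace_le_domain _ _ hk⟩ u
    rw [(hDK _).1 hk, inner_zero_left] at this
    exact this.symm
  have hPmem : ∀ u, P u ∈ K := fun u => K.starProjection_apply_mem u
  have hPP : ∀ u, P (P u) = P u := fun u => K.starProjection_eq_self_iff.2 (hPmem u)
  have huniq : ∀ v w : A.domain, D v = D w → P (v : H) = 0 → P (w : H) = 0 → v = w := by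
    intro v w hvw hv hw
    have h1 : ((v - w : A.domain) : H) ∈ K := by
      rw [hDK, map_sub, hvw, sub_self]
    have h2 : P ((v - w : A.domain) : H) = 0 := by
      rw [Submodule.coe_sub, map_sub, hv, hw, sub_self]
    rw [hP, K.starProjection_eq_self_iff.2 h1] at h2
    exact sub_eq_zero.1 (Subtype.ext h2)
  -- `u - P u` as an element of the domain
  let proj : A.domain → A.domain := fun u =>
    u - ⟨P u, eigenspace_le_domain _ _ (hPmem u)⟩
  have hproj : ∀ u, D (proj u) = D u ∧ P (proj u : H) = 0 := by
    intro u
    constructor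
    · rw [map_sub, (hDK ⟨P u, _⟩).1 (hPmem u), sub_zero]
    · rw [Submodule.coe_sub, map_sub, hPP, sub_self]
  have hex : ∀ g, ∃ v : A.domain, D v = g - P g ∧ P (v : H) = 0 := by
    intro g
    obtain ⟨u, hu⟩ := hrange (g - P g) (by
      have := K.sub_starProjection_mem_orthogonal g
      exact (Submodule.mem_orthogonal _ _).1 this)
    exact ⟨proj u, (hproj u).1.trans hu, (hproj u).2⟩
  choose s hs hPs using hex
  let S : H →ₗ[ℂ] H :=
    { toFun := fun g => s g
      map_add' := fun g g' => by
        rw [huniq (s (g + g')) (s g + s g') (by rw [map_add, hs, hs, hs, map_add]; abel)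
          (hPs _) (by rw [Submodule.coe_add, map_add, hPs, hPs, add_zero])]
        rfl
      map_smul' := fun c g => by
        rw [huniq (s (c • g)) (c • s g) (by rw [map_smul, hs, hs, map_smul, smul_sub])
          (hPs _) (by rw [Submodule.coe_smul, map_smul, hPs, smul_zero])]
        rfl }
  have horth : ∀ g h, inner ℂ (s g : H) (P h) = 0 ∧ inner ℂ (P h) (s g : H) = 0 := by
    intro g h
    have := (Submodule.starProjection_apply_eq_zero_iff K).1 (hPs g)
    exact ⟨(Submodule.mem_orthogonal' _ _).1 this _ (hPmem h),
      (Submodule.mem_orthogonal _ _).1 this _ (hPmem h)⟩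
  have hS : S.IsSymmetric := by
    intro g h
    change inner ℂ (s g : H) h = inner ℂ g (s h : H)
    have h1 := hDsym (s g) (s h)
    rw [hs, hs, inner_sub_left, inner_sub_right, (horth _ _).1, (horth _ _).2, sub_zero,
      sub_zero] at h1
    exact h1.symm
  refine ⟨⟨S, hS.continuous⟩, fun u => ⟨(s u).2, hs u⟩, fun u => ?_, fun u => ?_, fun u => hPs u⟩
  · change ((s (D u) : A.domain) : H) = _
    rw [huniq (s (D u)) (proj u) (by rw [hs, hPD, sub_zero, (hproj u).1]) (hPs _) (hproj u).2]
    rfl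
  · change ((s (P u) : A.domain) : H) = _
    rw [huniq (s (P u)) 0 (by rw [hs, hPP, sub_self, map_zero]) (hPs _) (by simp)]
    rfl

/-- Near `lam` the resolvent of `A` is the sum of an analytic function and
`- (z - lam)⁻¹ • P`, where `P` is the orthogonal projection onto the eigenspace. -/
theorem exists_resolvent_expansion [CompleteSpace H] {A : H →ₗ.[ℂ] H} {lam : ℝ}
    [FiniteDimensional ℂ (eigenspace A (lam : ℂ))]
    (hsym : ∀ x y : A.domain, inner ℂ (A x) (y : H) = inner ℂ (x : H) (A y))
    (hrange : ∀ z, (∀ u ∈ eigenspace A (lam : ℂ), inner ℂ u z = 0) →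
      ∃ u : A.domain, A u - (lam : ℂ) • (u : H) = z) :
    ∃ r > 0, ∃ Q : ℂ → H →L[ℂ] H, DifferentiableOn ℂ Q (Metric.ball (lam : ℂ) r) ∧
      ∀ z ∈ Metric.ball (lam : ℂ) r, z ≠ lam →
        IsResolventAt A z (Q z - (z - lam)⁻¹ • (eigenspace A (lam : ℂ)).starProjection) := by
  obtain ⟨S, hS1, hS2, hS3, hS4⟩ := exists_reducedResolvent hsym hrange
  set K := eigenspace A (lam : ℂ) with hK
  set P := K.starProjection with hP
  have hunit : ∀ z ∈ Metric.ball (lam : ℂ) (1 / (‖S‖ + 1)), IsUnit (1 - (z - lam) • S) := by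
    intro z hz
    apply isUnit_one_sub_of_norm_lt_one
    rw [Metric.mem_ball, dist_eq_norm, lt_div_iff₀ (by positivity)] at hz
    rw [norm_smul]
    nlinarith [norm_nonneg (z - (lam : ℂ)), norm_nonneg S]
  refine ⟨1 / (‖S‖ + 1), by positivity, fun z => S * Ring.inverse (1 - (z - (lam : ℂ)) • S),
    fun z hz => ?_, fun z hz hne => ?_⟩
  · refine DifferentiableAt.differentiableWithinAt ?_
    have h1 : DifferentiableAt ℂ (fun z : ℂ => (1 : H →L[ℂ] H) - (z - (lam : ℂ)) • S) z := by
      fun_prop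
    have h2 := (differentiableAt_inverse (𝕜 := ℂ) (hunit z hz)).comp z h1
    exact (differentiableAt_const S).mul h2
  · obtain ⟨N, hN⟩ : ∃ N, N = Ring.inverse (1 - (z - (lam : ℂ)) • S) := ⟨_, rfl⟩
    change IsResolventAt A z (S * Ring.inverse (1 - (z - (lam : ℂ)) • S) - (z - (lam : ℂ))⁻¹ • P)
    rw [← hN]
    have hNl : N * (1 - (z - (lam : ℂ)) • S) = 1 := by
      rw [hN]; exact Ring.inverse_mul_cancel _ (hunit z hz)
    have hNr : (1 - (z - (lam : ℂ)) • S) * N = 1 := by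
      rw [hN]; exact Ring.mul_inverse_cancel _ (hunit z hz)
    have hcomm : S * N = N * S := by
      have h1 : (1 - (z - (lam : ℂ)) • S) * S = S * (1 - (z - (lam : ℂ)) • S) := by
        simp [sub_mul, mul_sub]
      calc S * N = N * (1 - (z - (lam : ℂ)) • S) * S * N := by rw [hNl, one_mul]
        _ = N * S * ((1 - (z - (lam : ℂ)) • S) * N) := by
          rw [mul_assoc N, h1]; simp only [mul_assoc]
        _ = N * S := by rw [hNr, mul_one]
    have hε : z - (lam : ℂ) ≠ 0 := sub_ne_zero.2 hne
    have e1 : ∀ u, N u - (z - (lam : ℂ)) • S (N u) = u := fun u => by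
      simpa using congrArg (fun T : H →L[ℂ] H => T u) hNr
    have e2 : ∀ u, N u - (z - (lam : ℂ)) • N (S u) = u := fun u => by
      simpa using congrArg (fun T : H →L[ℂ] H => T u) hNl
    have e3 : ∀ u, P (N u) = P u := fun u => by
      conv_rhs => rw [← e1 u, map_sub, map_smul, hS4, smul_zero, sub_zero]
    have e4 : ∀ u, N (P u) = P u := fun u => by
      simpa [hS3] using e2 (P u)
    have e5 : ∀ u, S (N u) = N (S u) := fun u =>
      congrArg (fun T : H →L[ℂ] H => T u) hcomm
    have hPmem : ∀ u, P u ∈ K := fun u => K.starProjection_apply_mem u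
    have hPdom : ∀ u, ∃ h : P u ∈ A.domain, A ⟨P u, h⟩ = (lam : ℂ) • P u := fun u =>
      (mem_eigenspace A _ _).1 (hPmem u)
    constructor
    · intro u
      obtain ⟨h1, h1'⟩ := hS1 (N u)
      obtain ⟨h2, h2'⟩ := hPdom u
      have hmem : S (N u) - (z - (lam : ℂ))⁻¹ • P u ∈ A.domain :=
        A.domain.sub_mem h1 (A.domain.smul_mem _ h2)
      refine ⟨hmem, ?_⟩
      have hval : A ⟨S (N u) - (z - (lam : ℂ))⁻¹ • P u, hmem⟩ =
          A ⟨S (N u), h1⟩ - (z - (lam : ℂ))⁻¹ • A ⟨P u, h2⟩ := by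
        rw [← LinearPMap.map_smul, ← LinearPMap.map_sub]
        rfl
      change A ⟨S (N u) - (z - (lam : ℂ))⁻¹ • P u, hmem⟩ -
        z • (S (N u) - (z - (lam : ℂ))⁻¹ • P u) = u
      rw [hval, h2', sub_eq_iff_eq_add.1 h1', e3]
      have e6 : z • (z - (lam : ℂ))⁻¹ • P u =
          P u + (z - (lam : ℂ))⁻¹ • (lam : ℂ) • P u := by
        rw [smul_smul, smul_smul, ← one_smul ℂ (P u), smul_smul, smul_smul, ← add_smul]
        congr 1
        field_simp
        ring
      rw [smul_sub, e6]
      have := e1 u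
      rw [sub_smul] at this
      calc _ = N u - (z • S (N u) - (lam : ℂ) • S (N u)) := by abel
        _ = u := this
    · intro u
      have hPD : P (A u - (lam : ℂ) • (u : H)) = 0 := by
        rw [hP, Submodule.starProjection_apply_eq_zero_iff, Submodule.mem_orthogonal]
        intro k hk
        obtain ⟨hk1, hk2⟩ := (mem_eigenspace A _ _).1 hk
        have := hsym ⟨k, hk1⟩ u
        rw [hk2, inner_smul_left, Complex.conj_ofReal] at this
        rw [inner_sub_right, inner_smul_right, ← this, sub_self]
      have hsplit : A u - z • (u : H) =
          (A u - (lam : ℂ) • (u : H)) - (z - (lam : ℂ)) • (u : H) := by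
        rw [sub_smul]; abel
      change S (N (A u - z • (u : H))) - (z - (lam : ℂ))⁻¹ • P (A u - z • (u : H)) = u
      have hSw := hS2 u
      rw [hsplit]
      generalize A u - (lam : ℂ) • (u : H) = w at hPD hSw ⊢
      rw [e5, map_sub, map_sub, map_sub, hPD, hSw, map_smul, map_smul, map_smul, map_sub,
        e4, zero_sub, smul_neg, smul_smul, inv_mul_cancel₀ hε, one_smul]
      have := e2 u
      calc _ = N u - (z - (lam : ℂ)) • N (S u) := by abel
        _ = u := this

end UnboundedOperator

/-! ### Ranks of matrices -/

theorem Matrix.rank_neg_eq {ι : Type*} [Fintype ι] (A : Matrix ι ι ℂ) : (-A).rank = A.rank := by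
  have : (-A).mulVecLin = -A.mulVecLin := by
    ext1 v
    simp
  rw [Matrix.rank, this, LinearMap.range_neg, Matrix.rank]

theorem Matrix.rank_eq_zero_iff_eq_zero {ι : Type*} [Fintype ι] (A : Matrix ι ι ℂ) :
    A.rank = 0 ↔ A = 0 := by
  classical
  rw [Matrix.rank, Submodule.finrank_eq_zero, LinearMap.range_eq_bot, ← Matrix.toLin'_apply',
    LinearEquiv.map_eq_zero_iff]

open scoped ComplexOrder in
/-- The rank of the Gram matrix of the projections of finitely many vectors `y i` onto `K`, if
these projections span `K`. -/
theorem rank_gram_starProjection {H : Type*} [NormedAddCommGroup H] [InnerProductSpace ℂ H]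
    {ι : Type*} [Fintype ι] (K : Submodule ℂ H) [FiniteDimensional ℂ K] (y : ι → H)
    (hy : ∀ u ∈ K, (∀ i, inner ℂ (y i) u = 0) → u = 0) :
    (Matrix.of fun i j => inner ℂ (y i) (K.starProjection (y j))).rank =
      Module.finrank ℂ K := by
  let b := stdOrthonormalBasis ℂ K
  let X : Matrix ι (Fin (Module.finrank ℂ K)) ℂ := Matrix.of fun i n => inner ℂ (y i) (b n : H)
  have hX : (Matrix.of fun i j => inner ℂ (y i) (K.starProjection (y j))) =
      X * X.conjTranspose := by
    ext i j
    simp only [Matrix.of_apply, Matrix.mul_apply, Matrix.conjTranspose_apply, X]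
    have h1 : K.starProjection (y j) = ∑ n, inner ℂ (b n : H) (y j) • (b n : H) := by
      have := congrArg (fun u : K => (u : H)) (b.sum_repr' (K.orthogonalProjectionOnto (y j)))
      simp only [Submodule.coe_sum, Submodule.coe_smul] at this
      rw [Submodule.starProjection_apply, ← this]
      refine Finset.sum_congr rfl fun n _ => ?_
      rw [← Submodule.inner_orthogonalProjectionOnto_eq_of_mem_left]
    rw [h1, inner_sum]
    refine Finset.sum_congr rfl fun n _ => ?_
    rw [inner_smul_right, mul_comm, RCLike.star_def, inner_conj_symm]
  rw [hX, Matrix.rank_self_mul_conjTranspose, Matrix.rank, LinearMap.finrank_range_of_inj]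
  · simp
  · rw [← LinearMap.ker_eq_bot, LinearMap.ker_eq_bot']
    intro c hc
    have h2 : ((∑ n, c n • b n : K) : H) = 0 := by
      refine hy _ (Submodule.coe_mem _) fun i => ?_
      have := congrFun hc i
      simp only [Submodule.coe_sum, Submodule.coe_smul, inner_sum, inner_smul_right]
      simpa [Matrix.mulVec, dotProduct, X, mul_comm] using this
    have h3 : ∑ n, c n • b n = 0 := Subtype.ext h2
    have h4 := (Fintype.linearIndependent_iff.1 b.orthonormal.linearIndependent) c
      (by simpa using h3)
    exact funext h4

/-! ### Cycles in graphs without leaves -/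

namespace MetricGraph

variable {V E : Type*} {G : MetricGraph V E}

/-- A nonempty subgraph without vertices of degree one contains a cycle: follow a path without
immediate reversals until it first returns to a vertex. -/
theorem exists_isCycle_of_hasNoLeaf [Finite V] {S : Set E} (hS : G.HasNoLeaf S)
    (hne : S.Nonempty) :
    ∃ (n : ℕ) (d : Fin (n + 1) → E × Bool), G.IsCycle d ∧ ∀ i, (d i).1 ∈ S := by
  have hnext : ∀ p : {p : E × Bool // p.1 ∈ S}, ∃ q : {p : E × Bool // p.1 ∈ S},
      G.vertex p = G.vertex (q.1.1, !q.1.2) ∧ q.1 ≠ (p.1.1, !p.1.2) := by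
    rintro ⟨p, hp⟩
    by_contra! hcon
    refine hS (G.vertex p) (Set.ncard_eq_one.2 ⟨p, ?_⟩)
    ext ⟨e, b⟩
    simp only [Set.mem_ofPred_eq, Set.mem_singleton_iff]
    constructor
    · rintro ⟨he, hv⟩
      have := hcon ⟨(e, !b), he⟩ (by simpa using hv.symm)
      simpa [Prod.ext_iff] using this
    · rintro rfl
      exact ⟨hp, rfl⟩
  choose next hjoin hback using hnext
  obtain ⟨e₀, he₀⟩ := hne
  let d : ℕ → {p : E × Bool // p.1 ∈ S} := fun n => next^[n] ⟨(e₀, false), he₀⟩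
  have hd : ∀ n, d (n + 1) = next (d n) := fun n => Function.iterate_succ_apply' _ _ _
  have hjoin' : ∀ n, G.vertex (d n).1 = G.vertex ((d (n + 1)).1.1, !(d (n + 1)).1.2) := fun n => by
    rw [hd]; exact hjoin _
  have hback' : ∀ n, (d (n + 1)).1 ≠ ((d n).1.1, !(d n).1.2) := fun n => by
    rw [hd]; exact hback _
  have hex : ∃ m, 0 < m ∧ ∃ i, G.vertex (d i).1 = G.vertex (d (i + m)).1 := by
    obtain ⟨i, j, hij, h⟩ := Finite.exists_ne_map_eq_of_infinite fun n => G.vertex (d n).1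
    rcases lt_or_gt_of_ne hij with hlt | hlt
    · exact ⟨j - i, by omega, i, by rw [Nat.add_sub_cancel' hlt.le]; exact h⟩
    · exact ⟨i - j, by omega, j, by rw [Nat.add_sub_cancel' hlt.le]; exact h.symm⟩
  classical
  obtain ⟨hm, i, hi⟩ := Nat.find_spec hex
  have hmin : ∀ k l, k < l → l < k + Nat.find hex → G.vertex (d k).1 ≠ G.vertex (d l).1 := by
    intro k l hkl hlt heq
    refine Nat.find_min hex (m := l - k) (by omega) ⟨by omega, k, ?_⟩
    rwa [Nat.add_sub_cancel' hkl.le]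
  generalize Nat.find hex = m at hm hi hmin
  obtain ⟨n, rfl⟩ : ∃ n, m = n + 1 := ⟨m - 1, by omega⟩
  refine ⟨n, fun k => (d (i + 1 + k)).1, ⟨fun k => ?_, ?_, ?_⟩, fun k => (d _).2⟩
  · by_cases hk : k = Fin.last n
    · subst hk
      simp only [Fin.val_last, Fin.last_add_one, Fin.val_zero, add_zero]
      rw [← hjoin' i, hi]
      congr 3
      omega
    · have hk' : ((k + 1 : Fin (n + 1)) : ℕ) = k + 1 :=
        Fin.val_add_one_of_lt (lt_of_le_of_ne (Fin.le_last k) hk)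
      simp only [hk']
      exact hjoin' (i + 1 + k)
  · -- A repeated edge would be traversed in opposite directions, so the path between the two
    -- traversals would be closed and shorter, or an immediate reversal.
    have key : ∀ k l : Fin (n + 1), k < l → (d (i + 1 + k)).1.1 ≠ (d (i + 1 + l)).1.1 := by
      intro k l hkl he
      have hkl' : (k : ℕ) < l := hkl
      have hl := l.2
      by_cases hb : (d (i + 1 + k)).1.2 = (d (i + 1 + l)).1.2
      · exact hmin _ _ (by omega) (by omega) (congrArg G.vertex (Prod.ext he hb))
      · have hrev : (d (i + 1 + k)).1 = ((d (i + 1 + l)).1.1, !(d (i + 1 + l)).1.2) :=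
          Prod.ext he (by simpa [Bool.eq_not] using hb)
        obtain ⟨l', hl'⟩ : ∃ l', i + 1 + (l : ℕ) = l' + 1 := ⟨i + l, by omega⟩
        rw [hl'] at hrev
        have hv : G.vertex (d (i + 1 + k)).1 = G.vertex (d l').1 := by
          rw [hjoin' l', hrev]
        rcases Nat.lt_or_ge (i + 1 + k) l' with hlt | hge
        · exact hmin _ _ hlt (by omega) hv
        · have : i + 1 + (k : ℕ) = l' := by omega
          rw [this] at hrev
          apply hback' l'
          rw [hrev]
          simp
    intro k l hkl
    rcases lt_trichotomy k l with h | h | h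
    · exact absurd hkl (key k l h)
    · exact h
    · exact absurd hkl.symm (key l k h)
  · intro k l hkl
    rcases lt_trichotomy k l with h | h | h
    · exact absurd hkl (hmin _ _ (by have : (k : ℕ) < l := h; omega) (by omega))
    · exact h
    · exact absurd hkl.symm (hmin _ _ (by have : (l : ℕ) < k := h; omega) (by omega))

/-! ### Unique continuation from `B` -/

section UniqueContinuation

variable {f : E → ℝ → ℂ}

theorem outDeriv_eq_zero_of_eqOn {p : E × Bool} (h : ∀ x ∈ G.edge p.1, f p.1 x = 0) :
    G.outDeriv f p = 0 := by
  have hz : ∀ x ∈ G.edge p.1, G.edgeDeriv f p.1 x = 0 := fun x hx => by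
    have : G.edgeDeriv f p.1 x = derivWithin (fun _ => (0 : ℂ)) (G.edge p.1) x :=
      derivWithin_congr h (h x hx)
    rw [this, derivWithin_fun_const]
    rfl
  simp [outDeriv, hz _ (left_mem _), hz _ (right_mem _)]

/-- A solution whose value and derivative vanish at an endpoint of an edge vanishes on the edge. -/
theorem IsAC2.eqOn_zero {lam : ℝ} (hf : G.IsAC2 f)
    (hode : ∀ e, ∀ᵐ x ∂G.edgeMeasure e, G.laplacian f e x = (lam : ℂ) * f e x)
    {p : E × Bool} (h0 : f p.1 (G.coord p) = 0) (h1 : G.outDeriv f p = 0) :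
    ∀ x ∈ G.edge p.1, f p.1 x = 0 := by
  obtain ⟨C, S, h⟩ := exists_isFundamentalSystem lam
  obtain ⟨e, b⟩ := p
  suffices hab : f e 0 = 0 ∧ G.edgeDeriv f e 0 = 0 by
    intro x hx
    rw [(hf.eq_edgewise h hode hx).1]
    simp [edgewise, hab.1, hab.2]
  cases b
  · exact ⟨by simpa [coord] using h0, by simpa [outDeriv] using h1⟩
  · have h2 : f e (G.length e) = 0 := by simpa [coord] using h0
    have h3 : G.edgeDeriv f e (G.length e) = 0 := by simpa [outDeriv] using h1
    obtain ⟨e1, e2⟩ := hf.eq_edgewise h hode (right_mem e)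
    rw [h2, edgewise] at e1
    rw [h3, edgewiseDeriv] at e2
    have hw := h.wronskian_ofReal (G.length e)
    constructor
    · linear_combination -(C (G.length e) : ℂ) * e1 + (S (G.length e) : ℂ) * e2 - f e 0 * hw
    · linear_combination -(lam : ℂ) * (S (G.length e) : ℂ) * e1 - (C (G.length e) : ℂ) * e2 -
        G.edgeDeriv f e 0 * hw

/-- An eigenfunction that vanishes at the boundary vertices and at the proper core vertices is
zero, if no cycle has pairwise commensurable edge lengths. -/
theorem HasDefect.eqOn_zero [Fintype V] [Fintype E] {B : Finset V}
    (hboundary : ∀ v, G.IsBoundaryVertex v → v ∈ B)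
    (hcore : ∀ v, G.IsProperCoreVertex v → v ∈ B)
    (hcycle : ∀ (n : ℕ) (d : Fin (n + 1) → E × Bool), G.IsCycle d →
      ∃ i j, LinearIndependent ℚ ![G.length (d i).1, G.length (d j).1])
    {α : V → ℝ} {lam : ℝ} (hf : G.HasDefect α 0 f)
    (hode : ∀ e, ∀ᵐ x ∂G.edgeMeasure e, G.laplacian f e x = (lam : ℂ) * f e x)
    (hB : ∀ v ∈ B, G.vertexValue f v = 0) : ∀ e, ∀ x ∈ G.edge e, f e x = 0 := by
  classical
  -- `S` is the support of `f`, as a set of edges.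
  obtain ⟨S, hS⟩ : ∃ S : Set E, ∀ e, e ∉ S ↔ ∀ x ∈ G.edge e, f e x = 0 :=
    ⟨{e | ¬ ∀ x ∈ G.edge e, f e x = 0}, fun e => not_not⟩
  have hval : ∀ p : E × Bool, p.1 ∉ S → G.vertexValue f (G.vertex p) = 0 := fun p hp => by
    rw [← hf.cont.apply_coord]
    exact (hS _).1 hp _ (coord_mem p)
  have hleaf : G.HasNoLeaf S := by
    intro v hv
    obtain ⟨p, hp⟩ := Set.ncard_eq_one.1 hv
    have hmem : ∀ q : E × Bool, (q.1 ∈ S ∧ G.vertex q = v) ↔ q = p := fun q => by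
      simpa using Set.ext_iff.1 hp q
    obtain ⟨hpS, rfl⟩ := (hmem p).2 rfl
    have h0 : G.vertexValue f (G.vertex p) = 0 := by
      by_cases hb : G.IsBoundaryVertex (G.vertex p)
      · exact hB _ (hboundary _ hb)
      · obtain ⟨q, hqp, hqv⟩ : ∃ q, q ≠ p ∧ G.vertex q = G.vertex p := by
          by_contra! hcon
          refine hb (Set.ncard_eq_one.2 ⟨p, ?_⟩)
          ext q
          simp only [Set.mem_univ, true_and, Set.mem_ofPred_eq, Set.mem_singleton_iff]
          refine ⟨fun hq => ?_, fun hq => by rw [hq]⟩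
          by_contra hqp
          exact hcon q hqp hq
        rw [← hqv]
        exact hval q fun hqS => hqp ((hmem q).1 ⟨hqS, hqv⟩)
    have h1 : G.outDeriv f p = 0 := by
      have := hf.defect (G.vertex p)
      rw [h0, mul_zero, sub_zero, normalDeriv_eq_sum,
        Finset.sum_eq_single_of_mem p (by simp)] at this
      · exact this
      · intro q hq hqp
        refine outDeriv_eq_zero_of_eqOn ((hS _).1 fun hqS => hqp ((hmem q).1 ⟨hqS, ?_⟩))
        exact (Finset.mem_filter.1 hq).2
    refine (hS p.1).2 (hf.isAC2.eqOn_zero hode ?_ h1) hpS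
    rw [hf.cont.apply_coord, h0]
  have hvertex : ∀ v, G.vertexValue f v = 0 := by
    intro v
    by_cases hv : G.IsProperCoreVertex v
    · exact hB v (hcore v hv)
    · obtain ⟨p, rfl, hp⟩ : ∃ p, G.vertex p = v ∧ p.1 ∉ G.core := by
        by_contra! hcon
        exact hv hcon
      exact hval p fun hpS => hp (isGreatest_core G |>.2 hleaf hpS)
  obtain ⟨C, s, h⟩ := exists_isFundamentalSystem lam
  have hzero : ∀ e ∈ S, s (G.length e) = 0 := by
    intro e he
    have h0 : f e 0 = 0 := by
      have := hf.cont.apply_coord (e, false)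
      rwa [hvertex] at this
    have h1 : f e (G.length e) = 0 := by
      have := hf.cont.apply_coord (e, true)
      rwa [hvertex] at this
    rw [(hf.isAC2.eq_edgewise h hode (right_mem e)).1, edgewise, h0, zero_mul, zero_add,
      mul_eq_zero] at h1
    rcases h1 with h1 | h1
    · refine absurd he ((hS e).2 fun x hx => ?_)
      rw [(hf.isAC2.eq_edgewise h hode hx).1, edgewise, h0, h1]
      ring
    · exact_mod_cast h1
  by_contra hcon
  push Not at hcon
  obtain ⟨e, x, hx, hfx⟩ := hcon
  have hne : S.Nonempty := ⟨e, by
    by_contra he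
    exact hfx ((hS e).1 he x hx)⟩
  obtain ⟨n, d, hd, hdS⟩ := exists_isCycle_of_hasNoLeaf hleaf hne
  obtain ⟨i, j, hij⟩ := hcycle n d hd
  obtain ⟨m, k, hm, hmk⟩ := h.zeros _ _ (G.length_pos _) (G.length_pos _)
    (hzero _ (hdS i)) (hzero _ (hdS j))
  have := (LinearIndependent.pair_iff.1 hij (m : ℚ) (-k : ℚ) (by
    rw [Rat.smul_def, Rat.smul_def]
    push_cast
    linear_combination hmk)).1
  exact hm (by exact_mod_cast this)

end UniqueContinuation

end MetricGraph

/-! ### Matrix functions with at most a simple pole -/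

namespace MatrixFunction

variable {ι : Type*} {D : Set ℂ} {R : ℂ → Matrix ι ι ℂ} {z₀ : ℂ} {r : ℝ} {F : ι → ι → ℂ → ℂ}

/-- Cauchy's integral formula, on all sufficiently small circles. -/
theorem residue_eq_of_eq_inv_mul (hr : 0 < r)
    (hF : ∀ i j, DifferentiableOn ℂ (F i j) (Metric.ball z₀ r))
    (hR : ∀ z ∈ Metric.ball z₀ r, z ≠ z₀ → ∀ i j, R z i j = (z - z₀)⁻¹ * F i j z) :
    residue R z₀ = Matrix.of fun i j => F i j z₀ := by
  ext i j
  refine Tendsto.limUnder_eq (tendsto_const_nhds.congr' ?_)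
  filter_upwards [Ioo_mem_nhdsGT hr] with ρ hρ
  have h1 : DifferentiableOn ℂ (F i j) (Metric.closedBall z₀ ρ) :=
    (hF i j).mono (Metric.closedBall_subset_ball hρ.2)
  have h2 := h1.circleIntegral_sub_inv_smul (Metric.mem_ball_self hρ.1)
  have h3 : (∮ z in C(z₀, ρ), R z i j) = ∮ z in C(z₀, ρ), (z - z₀)⁻¹ • F i j z := by
    refine circleIntegral.integral_congr hρ.1.le fun z hz => ?_
    refine hR z (Metric.sphere_subset_closedBall.trans (Metric.closedBall_subset_ball hρ.2) hz)
      ?_ i j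
    rintro rfl
    simp [hρ.1.ne] at hz
  rw [h3, h2, smul_eq_mul]
  exact (inv_mul_cancel_left₀ Complex.two_pi_I_ne_zero _).symm

/-- If `(z - z₀) R(z)` extends analytically to `z₀`, then `z₀` is a pole exactly if the extension
does not vanish at `z₀`; the order of the pole is then one. -/
theorem isPole_iff_of_eq_inv_mul (hr : 0 < r)
    (hF : ∀ i j, DifferentiableOn ℂ (F i j) (Metric.ball z₀ r))
    (hD : ∀ z ∈ Metric.ball z₀ r, z ≠ z₀ → z ∈ D)
    (hR : ∀ z ∈ Metric.ball z₀ r, z ≠ z₀ → ∀ i j, R z i j = (z - z₀)⁻¹ * F i j z) :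
    IsPole D R z₀ ↔ (Matrix.of fun i j => F i j z₀) ≠ 0 := by
  have hlim : ∀ n, Tendsto (fun z => (z - z₀) ^ (n + 1) • R z) (𝓝[≠] z₀)
      (𝓝 ((0 : ℂ) ^ n • Matrix.of fun i j => F i j z₀)) := by
    intro n
    refine tendsto_pi_nhds.2 fun i => tendsto_pi_nhds.2 fun j => ?_
    have hc : ContinuousAt (F i j) z₀ :=
      ((hF i j).differentiableAt (Metric.ball_mem_nhds z₀ hr)).continuousAt
    have h1 : Tendsto (fun z => (z - z₀) ^ n * F i j z) (𝓝 z₀) (𝓝 ((z₀ - z₀) ^ n * F i j z₀)) :=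
      ContinuousAt.mul (by fun_prop) hc
    rw [sub_self] at h1
    refine (h1.mono_left nhdsWithin_le_nhds).congr' ?_
    filter_upwards [self_mem_nhdsWithin, mem_nhdsWithin_of_mem_nhds (Metric.ball_mem_nhds z₀ hr)]
      with z hz hz'
    have hne : z - z₀ ≠ 0 := sub_ne_zero.2 hz
    change (z - z₀) ^ n * F i j z = (z - z₀) ^ (n + 1) * R z i j
    rw [hR z hz' hz, pow_succ, mul_assoc, mul_inv_cancel_left₀ hne]
  constructor
  · rintro ⟨n, hn, -, L, hL, htend⟩ h0
    obtain ⟨m, rfl⟩ : ∃ m, n = m + 1 := ⟨n - 1, by omega⟩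
    refine hL (tendsto_nhds_unique htend ?_)
    simpa [h0] using hlim m
  · intro h0
    refine ⟨1, le_rfl, ⟨Metric.ball z₀ (r / 2), Metric.isOpen_ball,
      Metric.mem_ball_self (by positivity), ?_, fun i j => ?_⟩, _, h0, by simpa using hlim 0⟩
    · rintro z ⟨hz, hne⟩
      refine hD z ?_ hne
      have := Metric.mem_closedBall.1 (Metric.closure_ball_subset_closedBall hz)
      rw [Metric.mem_ball]
      linarith
    · have hopen : IsOpen (Metric.ball z₀ (r / 2) \ {z₀}) :=
        Metric.isOpen_ball.sdiff isClosed_singleton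
      refine DifferentiableOn.analyticOnNhd (fun z hz => ?_) hopen
      have hsub : ∀ z ∈ Metric.ball z₀ (r / 2) \ {z₀}, z ∈ Metric.ball z₀ r ∧ z ≠ z₀ :=
        fun z hz => ⟨Metric.ball_subset_ball (by linarith) hz.1, hz.2⟩
      have h1 : DifferentiableWithinAt ℂ (fun z => (z - z₀)⁻¹ * F i j z)
          (Metric.ball z₀ (r / 2) \ {z₀}) z := by
        refine DifferentiableWithinAt.mul ?_ ((hF i j z (hsub z hz).1).mono fun z hz =>
          (hsub z hz).1)
        exact ((differentiableAt_id.sub_const z₀).inv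
          (sub_ne_zero.2 (hsub z hz).2)).differentiableWithinAt
      exact h1.congr (fun z hz => hR z (hsub z hz).1 (hsub z hz).2 i j)
        (hR z (hsub z hz).1 (hsub z hz).2 i j)

end MatrixFunction

/-! ### The Titchmarsh–Weyl function in terms of the resolvent -/

namespace MetricGraph

variable {V E : Type*} {G : MetricGraph V E}

open Classical in
/-- The value at a vertex of a function in the domain is a difference of inner products, by Green's
identity with a test function. -/
theorem HasDefect.inner_sub_inner [Fintype V] [Fintype E] {α : V → ℝ} {k : V}
    {w f : E → ℝ → ℂ} (hw : G.HasDefect α (fun v => if v = k then 1 else 0) w)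
    (hf : G.HasDefect α 0 f) :
    inner ℂ hw.isAC2.isL2.toL2 hf.isL2_laplacian.toL2 -
      inner ℂ hw.isL2_laplacian.toL2 hf.isAC2.isL2.toL2 = G.vertexValue f k := by
  rw [hf.green hw]
  simp

theorem toL2_laplacian_add [Fintype E] {α : V → ℝ} {h k : V → ℂ} {f g : E → ℝ → ℂ}
    (hf : G.HasDefect α h f) (hg : G.HasDefect α k g) :
    (hf.add hg).isL2_laplacian.toL2 = hf.isL2_laplacian.toL2 + hg.isL2_laplacian.toL2 := by
  rw [← IsL2.toL2_add _ _ fun e => (hf.isL2_laplacian e).add (hg.isL2_laplacian e)]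
  exact IsL2.toL2_congr _ _ fun e => hf.isAC2.laplacian_add hg.isAC2 e

theorem toL2_laplacian_smul [Fintype E] {α : V → ℝ} {h : V → ℂ} {f : E → ℝ → ℂ} (c : ℂ)
    (hf : G.HasDefect α h f) :
    (hf.smul c).isL2_laplacian.toL2 = c • hf.isL2_laplacian.toL2 := by
  rw [← IsL2.toL2_smul _ _ fun e => (hf.isL2_laplacian e).const_smul c]
  exact IsL2.toL2_congr _ _ fun e => by rw [laplacian_smul]

theorem toL2_add_neg [Fintype E] {α : V → ℝ} {h k m : V → ℂ} {f g : E → ℝ → ℂ}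
    (hf : G.HasDefect α h f) (hg : G.HasDefect α k g)
    (hs : G.HasDefect α m (f + (-1 : ℂ) • g)) :
    hs.isAC2.isL2.toL2 = hf.isAC2.isL2.toL2 + (-1 : ℂ) • hg.isAC2.isL2.toL2 ∧
    hs.isL2_laplacian.toL2 = hf.isL2_laplacian.toL2 + (-1 : ℂ) • hg.isL2_laplacian.toL2 := by
  constructor
  · rw [← IsL2.toL2_smul _ _ (hg.smul (-1)).isAC2.isL2, ← IsL2.toL2_add]
  · rw [← toL2_laplacian_smul (-1) hg]
    exact toL2_laplacian_add hf (hg.smul (-1))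

/-- The equation `-f'' = μ f` almost everywhere, as an equation in `L² (G)`. -/
theorem isSolution_iff [Fintype E] {α : V → ℝ} {μ : ℂ} {h : V → ℂ} {f : E → ℝ → ℂ} :
    G.IsSolution α μ h f ↔ ∃ hf : G.HasDefect α h f,
      hf.isL2_laplacian.toL2 = μ • hf.isAC2.isL2.toL2 := by
  constructor
  · rintro ⟨h1, h2, h3, h4, h5⟩
    have hμ : G.IsL2 (μ • f) := fun e => (h1 e).const_smul μ
    have hlap : G.IsL2 (G.laplacian f) := fun e => (hμ e).ae_eq (EventuallyEq.symm (h3 e))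
    refine ⟨⟨h2, hlap, h4, h5⟩, ?_⟩
    rw [← IsL2.toL2_smul μ _ hμ]
    exact IsL2.toL2_congr _ _ h3
  · rintro ⟨hf, hlap⟩
    have hμ : G.IsL2 (μ • f) := fun e => (hf.isAC2.isL2 e).const_smul μ
    rw [← IsL2.toL2_smul μ _ hμ, IsL2.toL2_eq_toL2_iff] at hlap
    exact ⟨hf.isAC2.isL2, hf.isAC2, hlap, hf.cont, hf.defect⟩

open Classical in
/-- Krein-type formula: the entries of the Titchmarsh–Weyl function are obtained by correcting the
test functions by the resolvent and evaluating at the vertices through Green's identity. -/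
theorem titchmarshWeyl_apply [Fintype V] [Fintype E] {B : Finset V} {α : V → ℝ}
    {w : V → E → ℝ → ℂ} (hw : ∀ l, G.HasDefect α (fun v => if v = l then 1 else 0) (w l))
    (hw0 : ∀ l v, G.vertexValue (w l) v = 0) {μ : ℂ} {T : G.L2 →L[ℂ] G.L2}
    (hT : UnboundedOperator.IsResolventAt (G.deltaLaplacian α) μ T) (k l : B) {g : G.L2}
    (hg : g = (hw l).isL2_laplacian.toL2 - μ • (hw l).isAC2.isL2.toL2) :
    G.titchmarshWeyl B α μ k l = inner ℂ (hw k).isL2_laplacian.toL2 (T g) -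
      μ * inner ℂ (hw k).isAC2.isL2.toL2 (T g) - inner ℂ (hw k).isAC2.isL2.toL2 g := by
  have hex : ∃ f, G.IsSolution α μ (fun v => if v = (l : V) then 1 else 0) f := by
    obtain ⟨hdom, hA⟩ := hT.1 g
    obtain ⟨f, hf, hf1, hf2⟩ := mem_deltaLaplacian_graph.1
      ⟨hdom, (sub_eq_iff_eq_add.1 hA)⟩
    have hsum := (hw l).add (hf.smul (-1))
    rw [smul_zero, add_zero] at hsum
    refine ⟨_, isSolution_iff.2 ⟨hsum, ?_⟩⟩
    obtain ⟨e2, e1⟩ := toL2_add_neg (hw l) hf hsum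
    rw [e1, e2, hf1, hf2, hg]
    module
  have hsol : G.IsSolution α μ (fun v => if v = (l : V) then 1 else 0)
      (G.fundamentalSolution α μ l) := by
    rw [fundamentalSolution, dif_pos hex]
    exact hex.choose_spec
  obtain ⟨hf, hlap⟩ := isSolution_iff.1 hsol
  have hsum := hf.add ((hw l).smul (-1))
  have hzero : ((fun v => if v = (l : V) then (1 : ℂ) else 0) +
      (-1 : ℂ) • fun v => if v = (l : V) then (1 : ℂ) else 0) = 0 := by
    rw [neg_one_smul, add_neg_cancel]
  rw [hzero] at hsum
  obtain ⟨e2, e1⟩ := toL2_add_neg hf (hw l) hsum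
  have e3 : hsum.isL2_laplacian.toL2 = μ • hsum.isAC2.isL2.toL2 - g := by
    rw [e1, e2, hlap, hg]
    module
  have e4 : hsum.isAC2.isL2.toL2 = - T g := by
    obtain ⟨hdom, hA⟩ := mem_deltaLaplacian_graph.2 ⟨_, hsum, rfl, rfl⟩
    have := hT.2 ⟨_, hdom⟩
    rw [hA, e3, sub_sub_cancel_left, map_neg] at this
    exact this.symm
  have hval := (hw k).inner_sub_inner hsum
  rw [e3, e4] at hval
  have hval' : G.vertexValue (G.fundamentalSolution α μ l + (-1 : ℂ) • w l) k =
      G.vertexValue (G.fundamentalSolution α μ l) k + (-1 : ℂ) * G.vertexValue (w l) k := rfl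
  rw [hval', hw0, mul_zero, add_zero] at hval
  change G.vertexValue (G.fundamentalSolution α μ l) k = _
  rw [← hval, inner_sub_right, inner_smul_right, inner_neg_right, inner_neg_right]
  ring

end MetricGraph

/-! ### Eigenvalues and poles -/

theorem mainTheorem6 {V E : Type*} [Fintype V] [Fintype E] (G : MetricGraph V E)
    (B : Finset V)
    (hboundary : ∀ v, G.IsBoundaryVertex v → v ∈ B)
    (hcore : ∀ v, G.IsProperCoreVertex v → v ∈ B)
    (α : V → ℝ)
    (hcycle : ∀ (n : ℕ) (d : Fin (n + 1) → E × Bool), G.IsCycle d →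
      ∃ i j, LinearIndependent ℚ ![G.length (d i).1, G.length (d j).1])
    (lam : ℝ) :
    (UnboundedOperator.IsEigenvalue (G.deltaLaplacian α) (lam : ℂ) ↔
      MatrixFunction.IsPole (UnboundedOperator.resolventSet (G.deltaLaplacian α))
        (G.titchmarshWeyl B α) (lam : ℂ)) ∧
    Module.rank ℂ (UnboundedOperator.eigenspace (G.deltaLaplacian α) (lam : ℂ)) =
      ((MatrixFunction.residue (G.titchmarshWeyl B α) (lam : ℂ)).rank : Cardinal) := by
  classical
  have hfin := MetricGraph.finiteDimensional_eigenspace (G := G) α lam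
  obtain ⟨r, hr, Q, hQ, hres⟩ := UnboundedOperator.exists_resolvent_expansion
    (MetricGraph.deltaLaplacian_symmetric (G := G) α)
    (fun z hz => MetricGraph.exists_deltaLaplacian_sub_smul_eq α lam hz)
  set K := UnboundedOperator.eigenspace (G.deltaLaplacian α) (lam : ℂ) with hK
  choose w hw hw0 using MetricGraph.exists_hasDefect_single (G := G) α
  obtain ⟨x, hx⟩ : ∃ x : V → G.L2, ∀ l, x l = (hw l).isAC2.isL2.toL2 := ⟨_, fun _ => rfl⟩
  obtain ⟨y, hy⟩ : ∃ y : V → G.L2, ∀ l, y l = (hw l).isL2_laplacian.toL2 := ⟨_, fun _ => rfl⟩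
  -- `(z - lam) M(z)`, which is analytic near `lam`
  let F : B → B → ℂ → ℂ := fun k l z =>
    (z - lam) * (inner ℂ (y k) (Q z (y l - z • x l)) - z * inner ℂ (x k) (Q z (y l - z • x l)) -
      inner ℂ (x k) (y l - z • x l)) -
    (inner ℂ (y k) (K.starProjection (y l - z • x l)) -
      z * inner ℂ (x k) (K.starProjection (y l - z • x l)))
  have hF : ∀ k l, DifferentiableOn ℂ (F k l) (Metric.ball (lam : ℂ) r) := by
    intro k l
    have hg : DifferentiableOn ℂ (fun z : ℂ => y l - z • x l) (Metric.ball (lam : ℂ) r) := by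
      fun_prop
    have hinner : ∀ (u : G.L2) {v : ℂ → G.L2}, DifferentiableOn ℂ v (Metric.ball (lam : ℂ) r) →
        DifferentiableOn ℂ (fun z => inner ℂ u (v z)) (Metric.ball (lam : ℂ) r) := fun u v hv =>
      (innerSL ℂ u).differentiable.comp_differentiableOn hv
    have hQg := hQ.clm_apply hg
    have hPg := K.starProjection.differentiable.comp_differentiableOn hg
    have hz : DifferentiableOn ℂ (fun z : ℂ => z) (Metric.ball (lam : ℂ) r) := differentiableOn_id
    exact ((hz.sub_const _).mul (((hinner _ hQg).sub (hz.mul (hinner _ hQg))).sub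
      (hinner _ hg))).sub ((hinner _ hPg).sub (hz.mul (hinner _ hPg)))
  have hR : ∀ z ∈ Metric.ball (lam : ℂ) r, z ≠ lam → ∀ k l,
      G.titchmarshWeyl B α z k l = (z - lam)⁻¹ * F k l z := by
    intro z hz hne k l
    have hε : z - (lam : ℂ) ≠ 0 := sub_ne_zero.2 hne
    rw [MetricGraph.titchmarshWeyl_apply hw hw0 (hres z hz hne) k l (g := y l - z • x l)
      (by rw [hx, hy]), ← hx, ← hy]
    simp only [F, _root_.sub_apply, _root_.smul_apply, inner_sub_right,
      inner_smul_right, map_sub, map_smul]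
    field_simp
    ring
  have hFlam : (Matrix.of fun k l => F k l lam) = - Matrix.of fun k l : B =>
      inner ℂ (y k - (lam : ℂ) • x k) (K.starProjection (y l - (lam : ℂ) • x l)) := by
    ext k l
    simp only [F, Matrix.of_apply, Matrix.neg_apply, sub_self, zero_mul, zero_sub]
    rw [inner_sub_left (y k), inner_smul_left, Complex.conj_ofReal]
  -- The vectors `y k - lam • x k` represent the evaluations at the vertices on the eigenspace.
  have hrank : (Matrix.of fun k l => F k l lam).rank = Module.finrank ℂ K := by
    rw [hFlam, Matrix.rank_neg_eq,
      rank_gram_starProjection K fun k : B => y k - (lam : ℂ) • x k]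
    intro u hu hyu
    obtain ⟨f, hf, rfl, hode⟩ := MetricGraph.mem_eigenspace_deltaLaplacian.1 hu
    obtain ⟨_, hlap⟩ := MetricGraph.isSolution_iff.1
      (⟨hf.isAC2.isL2, hf.isAC2, hode, hf.cont, hf.defect⟩ : G.IsSolution α lam 0 f)
    have hzero := hf.eqOn_zero hboundary hcore hcycle hode fun v hv => by
      have h1 := (hw v).inner_sub_inner hf
      have h2 := hyu ⟨v, hv⟩
      rw [hlap, ← hx, ← hy, inner_smul_right] at h1
      rw [inner_sub_left, inner_smul_left, Complex.conj_ofReal] at h2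
      linear_combination -h1 - h2
    ext1 e
    refine (MemLp.toLp_congr (hf.isAC2.isL2 e) MemLp.zero ?_).trans (MemLp.toLp_zero _)
    filter_upwards [MetricGraph.ae_mem_edge e] with t ht using hzero e t ht
  have hpole := MatrixFunction.isPole_iff_of_eq_inv_mul
    (D := UnboundedOperator.resolventSet (G.deltaLaplacian α)) hr hF
    (fun z hz hne => ⟨_, hres z hz hne⟩) hR
  have hresid := MatrixFunction.residue_eq_of_eq_inv_mul hr hF hR
  refine ⟨?_, ?_⟩
  · rw [hpole, UnboundedOperator.IsEigenvalue, not_iff_not, ← hK, ← Submodule.finrank_eq_zero,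
      ← hrank, Matrix.rank_eq_zero_iff_eq_zero]
  · rw [hresid, hrank, Module.finrank_eq_rank]
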